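/- Let $d\ge 0$, $k\ge 1$ be integers, $\mathbb{T}^d=(\mathbb{R}/\mathbb{Z})^d$, and for $j\ge 0$ let $\mathbb{X}_j=\mathbb{R}^d\times(\mathbb{T}^d)^j$, with points $(x_0,x_1,\dots,x_j)$. Let $\rho\in C^\infty(\mathbb{X}_k;\mathbb{R})$ satisfy $c\le\rho\le C$ on $\mathbb{X}_k$ for some constants $0<c\le C<\infty$, and let $D\in C^\infty(\mathbb{X}_k;\mathbb{R}^{d\times d})$ be uniformly positive definite, i.e. $\xi\cdot D\xi\ge\lambda|\xi|^2$ on $\mathbb{X}_k$ for all $\xi\in\mathbb{R}^d$, with some constant $\lambda>0$ (symmetry of $D$ is not required). For fixed $(x_0,\dots,x_{k-1})\in\mathbb{X}_{k-1}$ let $$\mathcal{S}_k u=\frac1\rho\,\nabla_{x_k}\cdot\bigl(\rho\,D\,\nabla_{x_k}u\bigr).$$ Let $h\in C^\infty(\mathbb{X}_k;\mathbb{R})$ have bounded derivatives of every order $\ge 1$ and satisfy $$\int_{\mathbb{T}^d}h(x_0,\dots,x_k)\,\rho(x_0,\dots,x_k)\,dx_k=0\qquad\text{for all }(x_0,\dots,x_{k-1})\in\mathbb{X}_{k-1}.$$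 Then for every $(x_0,\dots,x_{k-1})\in\mathbb{X}_{k-1}$ there is exactly one $u(x_0,\dots,x_{k-1},\cdot)\in H^1(\mathbb{T}^d)$ which is a weak solution of the Poisson equation $\mathcal{S}_k u=h$ on $\mathbb{T}^d$, i.e. $$\int_{\mathbb{T}^d}\rho\,(D\nabla_{x_k}u)\cdot\nabla_{x_k}w\,dx_k=-\int_{\mathbb{T}^d}\rho\,h\,w\,dx_k\qquad\text{for all }w\in H^1(\mathbb{T}^d),$$ and has mean zero with respect to $\rho$, i.e. $\int_{\mathbb{T}^d}u\,\rho\,dx_k=0$. Moreover $u$, after modification on a null set of $\mathbb{T}^d$ for each value of the parameters, is a function in $C^\infty(\mathbb{X}_k)$, smooth jointly in $x_k\in\mathbb{T}^d$ and the parameters $(x_0,\dots,x_{k-1})\in\mathbb{X}_{k-1}$; it is bounded on $\mathbb{X}_k$, uniformly in all the variables; and it satisfies $\mathcal{S}_k u=h$ pointwise on $\mathbb{X}_k$. -/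

import Mathlib

open MeasureTheory
open scoped ContDiff

noncomputable section

namespace Multiscale

/-- The flat torus `𝕋^d = (ℝ/ℤ)^d`. Its `volume` is the product of the Lebesgue measures of total
mass one on the factors. -/
abbrev Torus (d : ℕ) : Type := UnitAddTorus (Fin d)

/-- The quotient map `ℝ^d → 𝕋^d`. -/
def proj {d : ℕ} (y : Fin d → ℝ) : Torus d := fun i => (y i : UnitAddCircle)

/-- The space `𝕏_m = ℝ^d × (𝕋^d)^m`, with points `(x_0, (x_1, …, x_m))`. In particular
`𝕏_0 = ℝ^d`. -/
abbrev Scales (d m : ℕ) : Type := (Fin d → ℝ) × (Fin m → Torus d)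

/-- The lift to `ℝ^d × (ℝ^d)^m × ℝ^d` of a function on `𝕏_{m+1} = 𝕏_m × 𝕋^d`
(a function of the parameters `(x_0, …, x_m)` and of the last variable `x_{m+1}`). -/
def lift {d m : ℕ} (f : Scales d m → Torus d → ℝ) :
    (Fin d → ℝ) × (Fin m → Fin d → ℝ) × (Fin d → ℝ) → ℝ :=
  fun z => f (z.1, fun j => proj (z.2.1 j)) (proj z.2.2)

/-- `f ∈ C^∞(𝕏_{m+1})`, jointly in all the variables. -/
def IsSmooth {d m : ℕ} (f : Scales d m → Torus d → ℝ) : Prop :=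
  ContDiff ℝ ∞ (lift f)

/-- All the derivatives of `f` of order at least one, in all the variables, are bounded. -/
def HasBoundedDerivatives {d m : ℕ} (f : Scales d m → Torus d → ℝ) : Prop :=
  ∀ n : ℕ, 1 ≤ n → ∃ C : ℝ, ∀ z, ‖iteratedFDeriv ℝ n (lift f) z‖ ≤ C

/-- `φ ∈ C^∞(𝕋^d)`. -/
def IsSmoothTorus {d : ℕ} (φ : Torus d → ℝ) : Prop :=
  ContDiff ℝ ∞ (fun y : Fin d → ℝ => φ (proj y))

/-- The classical partial derivative `∂_i φ` on the torus. -/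
def pderiv {d : ℕ} (i : Fin d) (φ : Torus d → ℝ) (y : Torus d) : ℝ :=
  deriv (fun t : ℝ => φ (y + Pi.single i (t : UnitAddCircle))) 0

/-- The operator `u ↦ ρ⁻¹ ∇ · (ρ D ∇ u)` on functions on the torus. -/
def ellipticOp {d : ℕ} (ρ : Torus d → ℝ) (D : Torus d → Matrix (Fin d) (Fin d) ℝ)
    (u : Torus d → ℝ) (y : Torus d) : ℝ :=
  (1 / ρ y) * ∑ i, pderiv i (fun z => ρ z * ∑ j, D z i j * pderiv j u z) y

/-- `u ∈ H^1(𝕋^d)` with weak gradient `G`: `u` and all `G i` are in `L^2(𝕋^d)`, and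
`∫ u ∂_i φ = - ∫ G_i φ` for every `φ ∈ C^∞(𝕋^d)`. -/
structure MemH1 {d : ℕ} (u : Torus d → ℝ) (G : Fin d → Torus d → ℝ) : Prop where
  memLp : MemLp u 2 volume
  memLp_grad : ∀ i, MemLp (G i) 2 volume
  weak_grad : ∀ i, ∀ φ : Torus d → ℝ, IsSmoothTorus φ →
    ∫ y, u y * pderiv i φ y = - ∫ y, G i y * φ y

/-- `u ∈ H^1(𝕋^d)` is a weak solution of `ρ⁻¹ ∇ · (ρ D ∇ u) = h`: after multiplication by `ρ`,
`∫ ρ (D ∇ u) · ∇ w = - ∫ ρ h w` for every `w ∈ H^1(𝕋^d)`. -/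
def IsWeakSolution {d : ℕ} (ρ : Torus d → ℝ) (D : Torus d → Matrix (Fin d) (Fin d) ℝ)
    (h u : Torus d → ℝ) : Prop :=
  ∃ G : Fin d → Torus d → ℝ, MemH1 u G ∧
    ∀ (w : Torus d → ℝ) (W : Fin d → Torus d → ℝ), MemH1 w W →
      ∫ y, ρ y * ∑ i, (∑ j, D y i j * G j y) * W i y = - ∫ y, ρ y * h y * w y

end Multiscale

end

namespace Multiscale

open UnitAddTorus

variable {d m : ℕ}

/-! Multiplying by `ρ` turns the equation into the divergence-form problem `∇ · (a ∇ v) = g` with `a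
= ρ D` and `g = ρ h`. It is solved first with Lebesgue mean zero, so that the Hilbert space `H1Zero`
does not depend on the parameters; subtracting the `ρ`-mean at the end gives `u`. The Poincaré
inequality, read off from Parseval, makes the form coercive; Lax-Milgram then gives existence
(`isUnit_formOp`), and coercivity gives uniqueness up to constants (`WeakForm.unique`).

Smoothness comes from a translation argument instead of elliptic regularity estimates. The operator
`formOp a` is linear and continuous in `a`, and inversion is smooth on units, so the solution is a
smooth `L^2`-valued function of any parameter on which the coefficients depend smoothly in the
uniform norm (`contDiff_weakSol`, `contDiff_family`). The translation by `t ∈ ℝ^d` is such a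
parameter, and by uniqueness translating the data translates the solution (`weakSol_translate`).
Hence the orbit `(x, t) ↦ v_x(· + t)` is smooth into `L^2`. Each `t`-derivative multiplies the
`n`-th Fourier coefficient by a factor `2πi n_i`, so the Fourier series can be weighted until it
converges absolutely, and it is then jointly smooth (`exists_smooth_of_orbit`).

The uniform bound is De Giorgi's level set iteration (`le_deGiorgiBound`). It uses only the lower
ellipticity constant and the supremum of `|g|`, which matters because `D` need not be bounded above
on the noncompact parameter space. The Sobolev inequality is replaced by a Faber-Krahn inequality
proved by counting Fourier modes (`faber_krahn`). The function `h` is itself bounded because its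
oscillation in the last variable is bounded and its `ρ`-mean vanishes (`exists_abs_le_of_centred`).
-/

/-! ### The quotient map and Fourier series on the torus -/

theorem isOpenQuotientMap_proj : IsOpenQuotientMap (proj : (Fin d → ℝ) → Torus d) := by
  have : (proj : (Fin d → ℝ) → Torus d) = Pi.map fun _ => (fun t : ℝ => (t : UnitAddCircle)) := rfl
  rw [this]
  exact IsOpenQuotientMap.piMap fun _ => QuotientAddGroup.isOpenQuotientMap_mk

theorem proj_surjective : Function.Surjective (proj : (Fin d → ℝ) → Torus d) :=
  isOpenQuotientMap_proj.surjective

theorem proj_add (x y : Fin d → ℝ) : proj (x + y) = proj x + proj y := by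
  ext i; simp [proj]

theorem proj_zero : proj (0 : Fin d → ℝ) = 0 := by
  ext i; simp [proj]

theorem proj_single (i : Fin d) (t : ℝ) :
    proj (Pi.single i t) = Pi.single i (t : UnitAddCircle) := by
  ext j
  by_cases h : j = i
  · subst h; simp [proj]
  · simp [proj, h]

theorem volume_torus :
    (volume : Measure (Torus d)) = Measure.pi fun _ => AddCircle.haarAddCircle := by
  have h : (volume : Measure UnitAddCircle) = AddCircle.haarAddCircle := by
    have := AddCircle.volume_eq_smul_haarAddCircle (T := 1)
    simpa using this
  rw [volume_pi]
  simp_rw [h]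

instance : IsProbabilityMeasure (volume : Measure (Torus d)) := by
  rw [volume_torus]; infer_instance


/-- Fourier coefficients of a real function on the torus. -/
noncomputable def fcoef (n : Fin d → ℤ) (f : Torus d → ℝ) : ℂ := ∫ y, mFourier (-n) y * (f y : ℂ)

theorem hasSum_sq_fcoef {f : Torus d → ℝ} (hf : MemLp f 2 volume) :
    HasSum (fun n => ‖fcoef n f‖ ^ 2) (∫ y, f y ^ 2) := by
  have hf' : MemLp (fun y => (f y : ℂ)) 2 (volume : Measure (Torus d)) := hf.ofReal
  rw [volume_torus] at hf'
  have := hasSum_sq_mFourierCoeff (hf'.toLp _)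
  have e1 : (fun n => ‖fcoef n f‖ ^ 2) = fun n => ‖mFourierCoeff (hf'.toLp _) n‖ ^ 2 := by
    ext n
    congr 2
    rw [fcoef, mFourierCoeff, volume_torus]
    refine integral_congr_ae ?_
    filter_upwards [hf'.coeFn_toLp] with y hy
    rw [hy, smul_eq_mul]
  have e2 : (∫ y, f y ^ 2) = ∫ y, ‖hf'.toLp _ y‖ ^ 2 ∂(Measure.pi fun _ => AddCircle.haarAddCircle) := by
    rw [volume_torus]
    refine integral_congr_ae ?_
    filter_upwards [hf'.coeFn_toLp] with y hy
    rw [hy]; simp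
  rw [e1, e2]
  exact this

/-- With summable coefficients the series converges in the uniform norm, hence in `L^2`, where its
sum must agree with the Fourier expansion of `f`. -/
theorem ae_eq_tsum_fcoef {f : Torus d → ℝ} (hf : MemLp f 2 volume)
    (hs : Summable fun n => fcoef n f) :
    f =ᵐ[volume] fun y => (∑' n, fcoef n f * mFourier n y).re := by
  have hf' : MemLp (fun y => (f y : ℂ)) 2 (volume : Measure (Torus d)) := hf.ofReal
  have e1 : ∀ n, fcoef n f = ∫ y, mFourier (-n) y * (f y : ℂ)
    ∂(Measure.pi fun _ => AddCircle.haarAddCircle) := by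
    intro n; rw [fcoef, volume_torus]
  have hS : Summable fun n => fcoef n f • (mFourier n : C(Torus d, ℂ)) := by
    refine Summable.of_norm ?_
    simpa [norm_smul, mFourier_norm] using hs.norm
  rw [volume_torus] at hf' ⊢
  have h1 := hasSum_mFourier_series_L2 (hf'.toLp _)
  have e2 : ∀ n, mFourierCoeff (hf'.toLp _) n = fcoef n f := by
    intro n
    rw [e1, mFourierCoeff]
    refine integral_congr_ae ?_
    filter_upwards [hf'.coeFn_toLp] with y hy
    rw [hy, smul_eq_mul]
  simp_rw [e2] at h1
  have h2 := hS.hasSum.mapL (ContinuousMap.toLp (E := ℂ) 2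
    (Measure.pi fun _ : Fin d => AddCircle.haarAddCircle) ℂ)
  simp only [map_smul] at h2
  have h3 := h1.unique h2
  have h4 := ContinuousMap.coeFn_toLp (E := ℂ) (p := 2) (𝕜 := ℂ)
    (Measure.pi fun _ : Fin d => AddCircle.haarAddCircle)
    (∑' n, fcoef n f • (mFourier n : C(Torus d, ℂ)))
  rw [← h3] at h4
  filter_upwards [hf'.coeFn_toLp, h4] with y hy1 hy2
  have h5 := (ContinuousMap.evalCLM ℂ y).hasSum hS.hasSum
  have h6 := h5.tsum_eq
  simp only [ContinuousMap.evalCLM_apply, ContinuousMap.smul_apply, smul_eq_mul] at h6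
  rw [h6, ← hy2, hy1, Complex.ofReal_re]

theorem mFourier_apply_add (n : Fin d → ℤ) (x y : Torus d) :
    mFourier n (x + y) = mFourier n x * mFourier n y := by
  simp only [mFourier, ContinuousMap.coe_mk, ← Finset.prod_mul_distrib]
  refine Finset.prod_congr rfl fun i _ => ?_
  simp [fourier_apply, smul_add, AddCircle.toCircle_add]

theorem mFourier_proj (n : Fin d → ℤ) (y : Fin d → ℝ) :
    mFourier n (proj y) = Complex.exp (2 * Real.pi * Complex.I * ∑ i, n i * (y i : ℂ)) := by
  simp only [mFourier, ContinuousMap.coe_mk, proj, fourier_coe_apply, Finset.mul_sum,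
    Complex.exp_sum]
  refine Finset.prod_congr rfl fun i _ => ?_
  congr 1
  push_cast
  ring

theorem norm_mFourier_apply (n : Fin d → ℤ) (y : Torus d) : ‖mFourier n y‖ = 1 := by
  simp only [mFourier, ContinuousMap.coe_mk, norm_prod, fourier_apply, Circle.norm_coe,
    Finset.prod_const_one]

theorem contDiff_mFourier_proj (n : Fin d → ℤ) :
    ContDiff ℝ ∞ fun y : Fin d → ℝ => mFourier n (proj y) := by
  simp_rw [mFourier_proj]
  refine ContDiff.cexp ?_
  refine contDiff_const.mul (ContDiff.sum fun i _ => contDiff_const.mul ?_)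
  exact Complex.ofRealCLM.contDiff.comp (contDiff_apply ℝ ℝ i)

theorem hasDerivAt_mFourier_single (n : Fin d → ℤ) (i : Fin d) (y : Torus d) :
    HasDerivAt (fun t : ℝ => mFourier n (y + Pi.single i (t : UnitAddCircle)))
      (2 * Real.pi * Complex.I * n i * mFourier n y) 0 := by
  have h : (fun t : ℝ => mFourier n (y + Pi.single i (t : UnitAddCircle))) =
      fun t : ℝ => mFourier n y * Complex.exp (2 * Real.pi * Complex.I * n i * (t : ℂ)) := by
    ext t
    rw [mFourier_apply_add, ← proj_single, mFourier_proj]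
    congr 2
    rw [Finset.sum_eq_single i]
    · simp; ring
    · intro j _ hj; simp [hj]
    · simp
  rw [h]
  have h2 : HasDerivAt (fun t : ℝ => (t : ℂ)) 1 0 := Complex.ofRealCLM.hasDerivAt
  have h3 := ((h2.const_mul (2 * Real.pi * Complex.I * n i)).cexp).const_mul (mFourier n y)
  refine h3.congr_deriv ?_
  simp only [Complex.ofReal_zero, mul_zero, Complex.exp_zero]
  ring

/-! ### Differentiation on the torus -/

theorem continuous_of_comp_proj {E : Type*} [TopologicalSpace E] {φ : Torus d → E}
    (h : Continuous fun y : Fin d → ℝ => φ (proj y)) : Continuous φ :=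
  isOpenQuotientMap_proj.isQuotientMap.continuous_iff.2 h

theorem hasDerivAt_single {φ : Torus d → ℝ}
    (h : Differentiable ℝ fun y : Fin d → ℝ => φ (proj y)) (i : Fin d) (y : Fin d → ℝ) (t : ℝ) :
    HasDerivAt (fun t : ℝ => φ (proj y + Pi.single i (t : UnitAddCircle)))
      (fderiv ℝ (fun y => φ (proj y)) (y + Pi.single i t) (Pi.single i 1)) t := by
  have h1 : (fun t : ℝ => φ (proj y + Pi.single i (t : UnitAddCircle))) =
      fun t => (fun y => φ (proj y)) (y + t • Pi.single i 1) := by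
    ext t
    simp only [proj_add, ← proj_single]
    congr 3
    ext j
    by_cases hj : j = i
    · subst hj; simp
    · simp [hj]
  rw [h1]
  have h2 : HasDerivAt (fun t : ℝ => y + t • (Pi.single i 1 : Fin d → ℝ)) (Pi.single i 1) t := by
    simpa using ((hasDerivAt_id t).smul_const (Pi.single i 1 : Fin d → ℝ)).const_add y
  have h3 : y + Pi.single i t = y + t • (Pi.single i 1 : Fin d → ℝ) := by
    rw [← Pi.single_smul]; simp
  rw [h3]
  exact (h _).hasFDerivAt.comp_hasDerivAt t h2

theorem pderiv_proj {φ : Torus d → ℝ} (h : Differentiable ℝ fun y : Fin d → ℝ => φ (proj y))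
    (i : Fin d) (y : Fin d → ℝ) :
    pderiv i φ (proj y) = fderiv ℝ (fun y => φ (proj y)) y (Pi.single i 1) := by
  have := (hasDerivAt_single h i y 0).deriv
  simpa [pderiv] using this

theorem hasDerivAt_pderiv {φ : Torus d → ℝ}
    (h : Differentiable ℝ fun y : Fin d → ℝ => φ (proj y)) (i : Fin d) (y : Torus d) (t : ℝ) :
    HasDerivAt (fun t : ℝ => φ (y + Pi.single i (t : UnitAddCircle)))
      (pderiv i φ (y + Pi.single i (t : UnitAddCircle))) t := by
  obtain ⟨y, rfl⟩ := proj_surjective y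
  have := hasDerivAt_single h i y t
  rwa [← pderiv_proj h, proj_add, proj_single] at this

theorem continuous_pderiv {φ : Torus d → ℝ} (h : ContDiff ℝ 1 fun y : Fin d → ℝ => φ (proj y))
    (i : Fin d) : Continuous (pderiv i φ) := by
  refine continuous_of_comp_proj ?_
  simp_rw [pderiv_proj (h.differentiable one_ne_zero)]
  exact (h.continuous_fderiv one_ne_zero).clm_apply continuous_const

theorem IsSmoothTorus.pderiv {φ : Torus d → ℝ} (h : IsSmoothTorus φ) (i : Fin d) :
    IsSmoothTorus (pderiv i φ) := by
  unfold IsSmoothTorus at h ⊢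
  simp_rw [pderiv_proj (h.differentiable (by simp))]
  exact (h.fderiv_right (m := ∞) (by simp)).clm_apply contDiff_const

theorem IsSmoothTorus.contDiff_one {φ : Torus d → ℝ} (h : IsSmoothTorus φ) :
    ContDiff ℝ 1 fun y : Fin d → ℝ => φ (proj y) := ContDiff.of_le h (by simp)

theorem integrable_of_continuous {E : Type*} [NormedAddCommGroup E] {φ : Torus d → E}
    (h : Continuous φ) : Integrable φ volume :=
  h.integrable_of_hasCompactSupport (HasCompactSupport.of_compactSpace φ)

theorem memLp_of_continuous {φ : Torus d → ℝ} (h : Continuous φ) : MemLp φ 2 volume :=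
  h.memLp_of_hasCompactSupport (HasCompactSupport.of_compactSpace φ)

/-- The integral of `φ(· + t e_i)` does not depend on `t`, by invariance of the measure;
differentiate under the integral at `t = 0`. -/
theorem integral_pderiv {φ : Torus d → ℝ} (h : ContDiff ℝ 1 fun y : Fin d → ℝ => φ (proj y))
    (i : Fin d) : ∫ y, pderiv i φ y = 0 := by
  have hc : Continuous φ := continuous_of_comp_proj h.continuous
  have hp := continuous_pderiv h i
  obtain ⟨C, hC⟩ := IsCompact.exists_bound_of_continuousOn (isCompact_univ) hp.continuousOn
  have h1 := hasDerivAt_integral_of_dominated_loc_of_deriv_le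
    (μ := (volume : Measure (Torus d))) (F := fun (t : ℝ) y => φ (y + Pi.single i (t : UnitAddCircle)))
    (F' := fun t y => pderiv i φ (y + Pi.single i (t : UnitAddCircle))) (x₀ := 0)
    (bound := fun _ => C) (s := Set.univ) Filter.univ_mem
    (Filter.Eventually.of_forall fun t => (hc.comp (by fun_prop)).aestronglyMeasurable)
    (integrable_of_continuous (hc.comp (by fun_prop)))
    (hp.comp (by fun_prop)).aestronglyMeasurable
    (Filter.Eventually.of_forall fun y t _ => hC _ (Set.mem_univ _))
    (integrable_const _)
    (Filter.Eventually.of_forall fun y t _ =>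
      hasDerivAt_pderiv (h.differentiable one_ne_zero) i y t)
  have h2 : (fun t : ℝ => ∫ y : Torus d, φ (y + Pi.single i (t : UnitAddCircle))) = fun _ => ∫ y, φ y := by
    ext t
    exact integral_add_right_eq_self (μ := volume) φ (Pi.single i (t : UnitAddCircle))
  have h3 := h1.2
  rw [h2] at h3
  have h4 := h3.unique (hasDerivAt_const _ _)
  simpa using h4

theorem pderiv_mul {φ ψ : Torus d → ℝ} (hφ : Differentiable ℝ fun y : Fin d → ℝ => φ (proj y))
    (hψ : Differentiable ℝ fun y : Fin d → ℝ => ψ (proj y)) (i : Fin d) (y : Torus d) :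
    pderiv i (fun z => φ z * ψ z) y = pderiv i φ y * ψ y + φ y * pderiv i ψ y := by
  have h1 := hasDerivAt_pderiv hφ i y 0
  have h2 := hasDerivAt_pderiv hψ i y 0
  refine (h1.mul h2).deriv.trans ?_
  simp

theorem pderiv_comp {g g' : ℝ → ℝ} (hg : ∀ s, HasDerivAt g (g' s) s) {φ : Torus d → ℝ}
    (hφ : Differentiable ℝ fun y : Fin d → ℝ => φ (proj y)) (i : Fin d) (y : Torus d) :
    pderiv i (fun z => g (φ z)) y = g' (φ y) * pderiv i φ y := by
  have h1 := hasDerivAt_pderiv hφ i y 0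
  refine ((hg _).comp 0 h1).deriv.trans ?_
  simp

theorem integral_mul_pderiv {φ ψ : Torus d → ℝ}
    (hφ : ContDiff ℝ 1 fun y : Fin d → ℝ => φ (proj y))
    (hψ : ContDiff ℝ 1 fun y : Fin d → ℝ => ψ (proj y)) (i : Fin d) :
    ∫ y, φ y * pderiv i ψ y = - ∫ y, pderiv i φ y * ψ y := by
  have h1 := integral_pderiv (φ := fun y => φ y * ψ y) (hφ.mul hψ) i
  have hφc : Continuous φ := continuous_of_comp_proj hφ.continuous
  have hψc : Continuous ψ := continuous_of_comp_proj hψ.continuous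
  simp_rw [pderiv_mul (hφ.differentiable one_ne_zero) (hψ.differentiable one_ne_zero)] at h1
  rw [integral_add] at h1
  · linarith
  · exact integrable_of_continuous ((continuous_pderiv hφ i).mul hψc)
  · exact integrable_of_continuous (hφc.mul (continuous_pderiv hψ i))

/-- A `C^1` function belongs to `H^1`, with its classical gradient. -/
theorem memH1_of_contDiff {φ : Torus d → ℝ} (hφ : ContDiff ℝ 1 fun y : Fin d → ℝ => φ (proj y)) :
    MemH1 φ fun i => pderiv i φ where
  memLp := memLp_of_continuous (continuous_of_comp_proj hφ.continuous)
  memLp_grad i := memLp_of_continuous (continuous_pderiv hφ i)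
  weak_grad i _ hψ := integral_mul_pderiv hφ hψ.contDiff_one i

/-! ### Fourier coefficients of weak derivatives -/

theorem isSmoothTorus_mFourier_re (n : Fin d → ℤ) :
    IsSmoothTorus fun y : Torus d => (mFourier n y).re :=
  Complex.reCLM.contDiff.comp (contDiff_mFourier_proj n)

theorem isSmoothTorus_mFourier_im (n : Fin d → ℤ) :
    IsSmoothTorus fun y : Torus d => (mFourier n y).im :=
  Complex.imCLM.contDiff.comp (contDiff_mFourier_proj n)

theorem pderiv_mFourier_re (n : Fin d → ℤ) (i : Fin d) (y : Torus d) :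
    pderiv i (fun y => (mFourier n y).re) y = -(2 * Real.pi * n i * (mFourier n y).im) := by
  have := (Complex.reCLM.hasFDerivAt.comp_hasDerivAt 0 (hasDerivAt_mFourier_single n i y)).deriv
  refine this.trans ?_
  simp [Complex.mul_re, Complex.mul_im]

theorem pderiv_mFourier_im (n : Fin d → ℤ) (i : Fin d) (y : Torus d) :
    pderiv i (fun y => (mFourier n y).im) y = 2 * Real.pi * n i * (mFourier n y).re := by
  have := (Complex.imCLM.hasFDerivAt.comp_hasDerivAt 0 (hasDerivAt_mFourier_single n i y)).deriv
  refine this.trans ?_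
  simp [Complex.mul_re, Complex.mul_im]

theorem integrable_mul_continuous {f : Torus d → ℝ} (hf : MemLp f 2 volume) {g : Torus d → ℝ}
    (hg : Continuous g) : Integrable (fun y => f y * g y) volume :=
  hf.integrable_mul (memLp_of_continuous hg)

theorem fcoef_eq {f : Torus d → ℝ} (hf : MemLp f 2 volume) (n : Fin d → ℤ) :
    fcoef n f = (∫ y, f y * (mFourier (-n) y).re : ℝ) +
      (∫ y, f y * (mFourier (-n) y).im : ℝ) * Complex.I := by
  have h1 : Integrable (fun y => mFourier (-n) y * (f y : ℂ)) volume := by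
    refine (hf.ofReal (K := ℂ)).integrable one_le_two |>.bdd_mul (c := 1)
      (mFourier (-n)).continuous.aestronglyMeasurable ?_
    exact Filter.Eventually.of_forall fun y => (norm_mFourier_apply _ _).le
  apply Complex.ext
  · have := Complex.reCLM.integral_comp_comm h1
    simp only [fcoef]
    rw [← Complex.reCLM_apply, ← this]
    simp [mul_comm]
  · have := Complex.imCLM.integral_comp_comm h1
    simp only [fcoef]
    rw [← Complex.imCLM_apply, ← this]
    simp [mul_comm]

theorem MemH1.fcoef_grad {u : Torus d → ℝ} {G : Fin d → Torus d → ℝ} (h : MemH1 u G)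
    (i : Fin d) (n : Fin d → ℤ) :
    fcoef n (G i) = 2 * Real.pi * Complex.I * n i * fcoef n u := by
  rw [fcoef_eq h.memLp, fcoef_eq (h.memLp_grad i)]
  have h1 := h.weak_grad i _ (isSmoothTorus_mFourier_re (-n))
  have h2 := h.weak_grad i _ (isSmoothTorus_mFourier_im (-n))
  simp_rw [pderiv_mFourier_re] at h1
  simp_rw [pderiv_mFourier_im] at h2
  have e1 : ∫ y, u y * -(2 * Real.pi * ((-n) i : ℤ) * (mFourier (-n) y).im) =
      2 * Real.pi * n i * ∫ y, u y * (mFourier (-n) y).im := by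
    rw [← integral_const_mul]
    congr 1; ext y; push_cast [Pi.neg_apply]; ring
  have e2 : ∫ y, u y * (2 * Real.pi * ((-n) i : ℤ) * (mFourier (-n) y).re) =
      -(2 * Real.pi * n i * ∫ y, u y * (mFourier (-n) y).re) := by
    rw [← integral_const_mul, ← integral_neg]
    congr 1; ext y; push_cast [Pi.neg_apply]; ring
  rw [e1] at h1
  rw [e2] at h2
  have h1' : ∫ y, G i y * (mFourier (-n) y).re =
    -(2 * Real.pi * n i * ∫ y, u y * (mFourier (-n) y).im) := by linarith
  have h2' : ∫ y, G i y * (mFourier (-n) y).im =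
    2 * Real.pi * n i * ∫ y, u y * (mFourier (-n) y).re := by linarith
  rw [h1', h2']
  push_cast
  ring_nf
  rw [Complex.I_sq]
  ring

theorem MemH1.sub {u v : Torus d → ℝ} {G H : Fin d → Torus d → ℝ} (hu : MemH1 u G)
    (hv : MemH1 v H) : MemH1 (fun y => u y - v y) fun i y => G i y - H i y where
  memLp := hu.memLp.sub hv.memLp
  memLp_grad i := (hu.memLp_grad i).sub (hv.memLp_grad i)
  weak_grad i φ hφ := by
    have c1 := continuous_of_comp_proj (ContDiff.continuous hφ)
    have c2 := continuous_of_comp_proj (ContDiff.continuous (hφ.pderiv i))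
    simp_rw [sub_mul]
    rw [integral_sub (integrable_mul_continuous hu.memLp c2)
      (integrable_mul_continuous hv.memLp c2),
      integral_sub (integrable_mul_continuous (hu.memLp_grad i) c1)
      (integrable_mul_continuous (hv.memLp_grad i) c1), hu.weak_grad i φ hφ, hv.weak_grad i φ hφ]
    ring

theorem memH1_const (c : ℝ) : MemH1 (fun _ : Torus d => c) fun _ _ => 0 := by
  have := memH1_of_contDiff (d := d) (φ := fun _ => c) contDiff_const
  convert this using 2
  ext y
  simp [pderiv]

/-- A function in `L^2` which is orthogonal to all smooth functions vanishes. -/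
theorem ae_eq_zero_of_forall_smooth {f : Torus d → ℝ} (hf : MemLp f 2 volume)
    (h : ∀ φ : Torus d → ℝ, IsSmoothTorus φ → ∫ y, f y * φ y = 0) : f =ᵐ[volume] 0 := by
  have h0 : ∀ n, fcoef n f = 0 := fun n => by
    rw [fcoef_eq hf, h _ (isSmoothTorus_mFourier_re _), h _ (isSmoothTorus_mFourier_im _)]
    simp
  have := ae_eq_tsum_fcoef hf (by simp [h0])
  simp only [h0, zero_mul, tsum_zero, Complex.zero_re] at this
  exact this

/-- The weak gradient is unique. -/
theorem MemH1.grad_unique {u : Torus d → ℝ} {G H : Fin d → Torus d → ℝ} (hG : MemH1 u G)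
    (hH : MemH1 u H) (i : Fin d) : G i =ᵐ[volume] H i := by
  have h := (hG.sub hH)
  have := ae_eq_zero_of_forall_smooth (h.memLp_grad i) fun φ hφ => by
    have := h.weak_grad i φ hφ
    simpa using this
  filter_upwards [this] with y hy
  simpa [sub_eq_zero] using hy

/-! ### Poincaré and Faber-Krahn inequalities -/

theorem MemH1.hasSum_grad {u : Torus d → ℝ} {G : Fin d → Torus d → ℝ} (h : MemH1 u G) :
    HasSum (fun n => (2 * Real.pi) ^ 2 * (∑ i, (n i : ℝ) ^ 2) * ‖fcoef n u‖ ^ 2)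
      (∑ i, ∫ y, G i y ^ 2) := by
  have h1 := hasSum_sum (s := Finset.univ) fun i _ => hasSum_sq_fcoef (h.memLp_grad i)
  refine h1.congr_fun fun n => ?_
  rw [Finset.mul_sum, Finset.sum_mul]
  refine Finset.sum_congr rfl fun i _ => ?_
  rw [h.fcoef_grad]
  simp only [norm_mul, Complex.norm_ofNat, Complex.norm_real, Complex.norm_I, Complex.norm_intCast,
    mul_pow, Real.norm_eq_abs, sq_abs]
  ring

theorem one_le_two_pi_sq : 1 ≤ (2 * Real.pi) ^ 2 := by
  nlinarith [Real.pi_gt_three]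

theorem fcoef_zero (f : Torus d → ℝ) : fcoef 0 f = (∫ y, f y : ℝ) := by
  simp only [fcoef, neg_zero, mFourier_zero, ContinuousMap.one_apply, one_mul]
  exact integral_ofReal

/-- Termwise comparison of Parseval sums: the zero mode is absent, and every other mode satisfies
`(2π)² |n|² ≥ 1`. -/
theorem MemH1.poincare {u : Torus d → ℝ} {G : Fin d → Torus d → ℝ} (h : MemH1 u G)
    (h0 : ∫ y, u y = 0) : ∫ y, u y ^ 2 ≤ ∑ i, ∫ y, G i y ^ 2 := by
  refine hasSum_le (fun n => ?_) (hasSum_sq_fcoef h.memLp) h.hasSum_grad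
  by_cases hn : n = 0
  · subst hn; simp [fcoef_zero, h0]
  · obtain ⟨i, hi⟩ := Function.ne_iff.1 hn
    have h1 : (1 : ℝ) ≤ (n i : ℝ) ^ 2 := by
      have : (1 : ℤ) ≤ n i ^ 2 := by
        have h' : n i ≠ 0 := hi
        have : 0 < n i ^ 2 := by positivity
        exact this
      exact_mod_cast this
    have h2 : (n i : ℝ) ^ 2 ≤ ∑ i, (n i : ℝ) ^ 2 :=
      Finset.single_le_sum (f := fun i => (n i : ℝ) ^ 2) (fun i _ => sq_nonneg _) (Finset.mem_univ i)
    have h3 : 1 ≤ (2 * Real.pi) ^ 2 * (∑ i, (n i : ℝ) ^ 2) :=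
      one_le_mul_of_one_le_of_one_le one_le_two_pi_sq (h1.trans h2)
    exact le_mul_of_one_le_left (sq_nonneg _) h3

theorem norm_fcoef_le (f : Torus d → ℝ) (n : Fin d → ℤ) : ‖fcoef n f‖ ≤ ∫ y, |f y| := by
  refine (norm_integral_le_integral_norm _).trans_eq ?_
  simp [norm_mFourier_apply]

/-- Cauchy-Schwarz on the set where `f ≠ 0`, obtained by integrating `2 s |f| ≤ f² + s² 1_{f ≠ 0}`
with the optimal `s = (∫ |f|) / A`. -/
theorem sq_integral_abs_le {f : Torus d → ℝ} (hf : Continuous f) {A : ℝ} (hA : 0 < A)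
    (hfA : volume.real {y | f y ≠ 0} ≤ A) : (∫ y, |f y|) ^ 2 ≤ A * ∫ y, f y ^ 2 := by
  set I := ∫ y, |f y|
  have hm : MeasurableSet {y | f y ≠ 0} := (isOpen_ne_fun hf continuous_const).measurableSet
  set s := I / A
  have i1 : Integrable (fun y => f y ^ 2) volume := integrable_of_continuous (hf.pow 2)
  have i2 : Integrable (fun y => s ^ 2 * {y | f y ≠ 0}.indicator (fun _ => (1 : ℝ)) y) volume :=
    ((integrable_const _).indicator hm).const_mul _
  have key : 2 * s * I ≤ (∫ y, f y ^ 2) + s ^ 2 * A := by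
    calc 2 * s * I = ∫ y, 2 * s * |f y| := (integral_const_mul _ _).symm
      _ ≤ ∫ y, (f y ^ 2 + s ^ 2 * {y | f y ≠ 0}.indicator (fun _ => (1 : ℝ)) y) := by
        refine integral_mono ((integrable_of_continuous hf.abs).const_mul _)
          (i1.add i2) fun y => ?_
        by_cases hy : f y = 0
        · simp [hy]
        · simp only [Set.indicator, Set.mem_ofPred_eq, ne_eq, hy, not_false_eq_true, if_true]
          nlinarith [sq_nonneg (|f y| - s), sq_abs (f y)]
      _ = (∫ y, f y ^ 2) + s ^ 2 * volume.real {y | f y ≠ 0} := by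
        rw [integral_add i1 i2, integral_const_mul,
          integral_indicator hm]
        simp
      _ ≤ _ := by gcongr
  have hs : s * A = I := div_mul_cancel₀ _ hA.ne'
  have : s ^ 2 * A = s * I := by rw [← hs]; ring
  have h2 : s * I ≤ ∫ y, f y ^ 2 := by linarith
  calc I ^ 2 = A * (s * I) := by rw [← hs]; ring
    _ ≤ _ := by gcongr

/-- A function living on a small set has little mass in low frequencies: each of the `(2R+1)^d`
modes in the box `|n_i| ≤ R` carries at most `A ∫ f²`, together at most half of `∫ f²`. The
remaining modes have `|n| ≥ R` and are controlled by the gradient. -/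
theorem faber_krahn {f : Torus d → ℝ} {G : Fin d → Torus d → ℝ} (h : MemH1 f G)
    (hf : Continuous f) (R : ℕ) {A : ℝ} (hA : 0 < A) (hfA : volume.real {y | f y ≠ 0} ≤ A)
    (hRA : (2 * R + 1) ^ d * A ≤ 1 / 2) :
    (R : ℝ) ^ 2 * ∫ y, f y ^ 2 ≤ 2 * ∑ i, ∫ y, G i y ^ 2 := by
  set S : Finset (Fin d → ℤ) := Fintype.piFinset fun _ => Finset.Icc (-(R : ℤ)) R
  have hcard : (S.card : ℝ) = (2 * R + 1) ^ d := by
    simp only [S, Fintype.card_piFinset, Int.card_Icc, Finset.prod_const, Finset.card_univ,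
      Fintype.card_fin]
    have : ((R : ℤ) + 1 - -(R : ℤ)).toNat = 2 * R + 1 := by omega
    rw [this]; push_cast; ring
  have hQ : 0 ≤ ∫ y, f y ^ 2 := integral_nonneg fun y => sq_nonneg _
  have h1 : HasSum (fun n => if n ∈ S then ‖fcoef n f‖ ^ 2 else 0) (∑ n ∈ S, ‖fcoef n f‖ ^ 2) := by
    have : HasSum (fun n => if n ∈ S then ‖fcoef n f‖ ^ 2 else 0)
        (∑ n ∈ S, if n ∈ S then ‖fcoef n f‖ ^ 2 else 0) :=
      hasSum_sum_of_ne_finset_zero fun n hn => by simp [hn]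
    rwa [Finset.sum_congr rfl fun n hn => if_pos hn] at this
  have h2 : ∑ n ∈ S, ‖fcoef n f‖ ^ 2 ≤ 1 / 2 * ∫ y, f y ^ 2 := by
    calc ∑ n ∈ S, ‖fcoef n f‖ ^ 2 ≤ ∑ n ∈ S, A * ∫ y, f y ^ 2 := by
          refine Finset.sum_le_sum fun n _ => ?_
          refine le_trans ?_ (sq_integral_abs_le hf hA hfA)
          gcongr
          exact norm_fcoef_le f n
      _ = ((2 * R + 1) ^ d * A) * ∫ y, f y ^ 2 := by
          rw [Finset.sum_const, nsmul_eq_mul, hcard]; ring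
      _ ≤ _ := by gcongr
  -- Termwise majorant of `R² ‖fcoef n f‖²`: the first summand suffices for `n ∈ S`, the gradient
  -- term for `n ∉ S`.
  have h3 := (h1.mul_left ((R : ℝ) ^ 2)).add h.hasSum_grad
  have h4 := hasSum_le (fun n => ?_) ((hasSum_sq_fcoef h.memLp).mul_left ((R : ℝ) ^ 2)) h3
  · have : (R : ℝ) ^ 2 * ∑ n ∈ S, ‖fcoef n f‖ ^ 2 ≤ (R : ℝ) ^ 2 * (1 / 2 * ∫ y, f y ^ 2) := by
      gcongr
    linarith
  · by_cases hn : n ∈ S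
    · simp only [hn, if_true]
      have : 0 ≤ (2 * Real.pi) ^ 2 * (∑ i, (n i : ℝ) ^ 2) * ‖fcoef n f‖ ^ 2 := by positivity
      linarith
    · simp only [hn, if_false, mul_zero, zero_add]
      obtain ⟨i, hi⟩ : ∃ i, n i ∉ Finset.Icc (-(R : ℤ)) R := by
        by_contra! hc
        exact hn (Fintype.mem_piFinset.2 hc)
      have h5 : (R : ℝ) ^ 2 ≤ (n i : ℝ) ^ 2 := by
        have : (R : ℤ) ^ 2 ≤ n i ^ 2 := by
          rw [sq_le_sq, Nat.abs_cast]
          rw [Finset.mem_Icc, ← abs_le] at hi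
          exact (not_le.1 hi).le
        exact_mod_cast this
      have h6 : (n i : ℝ) ^ 2 ≤ ∑ i, (n i : ℝ) ^ 2 :=
        Finset.single_le_sum (f := fun i => (n i : ℝ) ^ 2) (fun i _ => sq_nonneg _)
          (Finset.mem_univ i)
      have h7 : (R : ℝ) ^ 2 ≤ (2 * Real.pi) ^ 2 * ∑ i, (n i : ℝ) ^ 2 :=
        (h5.trans h6).trans (le_mul_of_one_le_left (by positivity) one_le_two_pi_sq)
      gcongr

/-! ### Truncations -/

theorem hasDerivAt_posPart_pow (k : ℝ) (n : ℕ) (s : ℝ) :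
    HasDerivAt (fun s => max (s - k) 0 ^ (n + 2)) ((n + 2) * max (s - k) 0 ^ (n + 1)) s := by
  rcases lt_trichotomy s k with h | h | h
  · have h1 : (fun s => max (s - k) 0 ^ (n + 2)) =ᶠ[nhds s] fun _ => 0 := by
      filter_upwards [Iio_mem_nhds h] with t ht
      rw [max_eq_right (by linarith [Set.mem_Iio.1 ht])]; simp
    rw [max_eq_right (by linarith)]
    simpa using (hasDerivAt_const s (0 : ℝ)).congr_of_eventuallyEq h1
  · subst h
    have : HasDerivAt (fun t : ℝ => max (t - s) 0 ^ (n + 2)) 0 s := by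
      rw [hasDerivAt_iff_isLittleO]
      simp only [sub_self, max_self, ne_eq, Nat.add_eq_zero_iff, OfNat.ofNat_ne_zero, and_false,
        not_false_eq_true, zero_pow, sub_zero, smul_zero]
      have h1 : (fun t : ℝ => max (t - s) 0 ^ (n + 2)) =O[nhds s] fun t => (t - s) ^ (n + 2) := by
        refine Asymptotics.IsBigO.of_bound 1 (Filter.Eventually.of_forall fun t => ?_)
        rw [one_mul, norm_pow, norm_pow]
        gcongr
        rw [Real.norm_eq_abs, Real.norm_eq_abs, abs_of_nonneg (le_max_right _ _)]
        exact max_le (le_abs_self _) (abs_nonneg _)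
      refine h1.trans_isLittleO ?_
      refine Asymptotics.IsLittleO.of_norm_left ?_
      simpa only [norm_pow] using Asymptotics.isLittleO_pow_sub_sub s (m := n + 2) (by omega)
    simpa using this
  · have h1 : (fun s => max (s - k) 0 ^ (n + 2)) =ᶠ[nhds s] fun s => (s - k) ^ (n + 2) := by
      filter_upwards [Ioi_mem_nhds h] with t ht
      rw [max_eq_left (by linarith [Set.mem_Ioi.1 ht])]
    rw [max_eq_left (by linarith)]
    have h2 := (((hasDerivAt_id s).sub_const k).pow (n + 2)).congr_of_eventuallyEq h1
    simpa using h2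

/-- Powers at least two of the positive part are `C^1`, so truncations of a smooth function can be
tested with the classical chain rule. -/
theorem contDiff_posPart_pow (k : ℝ) (n : ℕ) :
    ContDiff ℝ 1 fun s : ℝ => max (s - k) 0 ^ (n + 2) := by
  rw [contDiff_one_iff_deriv]
  refine ⟨fun s => (hasDerivAt_posPart_pow k n s).differentiableAt, ?_⟩
  have : deriv (fun s : ℝ => max (s - k) 0 ^ (n + 2)) = fun s =>
    (n + 2) * max (s - k) 0 ^ (n + 1) := funext fun s => (hasDerivAt_posPart_pow k n s).deriv
  rw [this]
  fun_prop

/-! ### De Giorgi's level set iteration -/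

/-- One step of the iteration: `faber_krahn` applies to `(v - k)₊²`, whose gradient is `2 (v - k)₊
∇v`. The cubic term in `hE` is split by `w³ ≤ η w⁴ + η⁻³` on `{v > k}`, and the quartic part is
absorbed. -/
theorem integral_posPart_pow_four_le {v : Torus d → ℝ}
    (hv : ContDiff ℝ 1 fun y : Fin d → ℝ => v (proj y)) {K : ℝ} (hK : 0 < K) (k : ℝ)
    (hE : ∑ i, ∫ y, (max (v y - k) 0 * pderiv i v y) ^ 2 ≤ K * ∫ y, max (v y - k) 0 ^ 3)
    {R : ℕ} (hR : 0 < R) {A : ℝ} (hA : 0 < A) (hvA : volume.real {y | k < v y} ≤ A)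
    (hRA : (2 * R + 1) ^ d * A ≤ 1 / 2) :
    ∫ y, max (v y - k) 0 ^ 4 ≤ (16 * K / R ^ 2) ^ 4 * A := by
  have hvc : Continuous v := continuous_of_comp_proj hv.continuous
  have hwc : Continuous fun y => max (v y - k) 0 := by fun_prop
  have hset : {y | max (v y - k) 0 ^ 2 ≠ 0} = {y | k < v y} := by
    ext y; simp
  have hF := faber_krahn (f := fun y => max (v y - k) 0 ^ 2)
    (memH1_of_contDiff ((contDiff_posPart_pow k 0).comp hv)) (hwc.pow 2) R hA
    (by rw [hset]; exact hvA) hRA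
  have hG : ∀ i, ∫ y, pderiv i (fun y => max (v y - k) 0 ^ 2) y ^ 2 =
      4 * ∫ y, (max (v y - k) 0 * pderiv i v y) ^ 2 := fun i => by
    rw [← integral_const_mul]
    congr 1; ext y
    rw [pderiv_comp (g := fun s => max (s - k) 0 ^ 2) (fun s => by
      simpa using hasDerivAt_posPart_pow k 0 s) (hv.differentiable one_ne_zero)]
    ring
  simp_rw [hG, ← Finset.mul_sum] at hF
  have hm : MeasurableSet {y | k < v y} := (isOpen_lt continuous_const hvc).measurableSet
  set Q := ∫ y, max (v y - k) 0 ^ 4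
  have hQ : ∫ y, (max (v y - k) 0 ^ 2) ^ 2 = Q := by
    congr 1; ext y; ring
  rw [hQ] at hF
  have hRr : (0 : ℝ) < R := by exact_mod_cast hR
  -- Chosen so that `8 K η = R² / 2`: half of the left side absorbs the quartic term.
  set η : ℝ := R ^ 2 / (16 * K) with hη
  have hη0 : 0 < η := by positivity
  have i1 : Integrable (fun y => η * max (v y - k) 0 ^ 4) volume :=
    (integrable_of_continuous (hwc.pow 4)).const_mul _
  have i2 : Integrable (fun y => (1 / η) ^ 3 * {y | k < v y}.indicator (fun _ => (1 : ℝ)) y)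
    volume := ((integrable_const _).indicator hm).const_mul _
  have h3 : ∫ y, max (v y - k) 0 ^ 3 ≤ η * Q + (1 / η) ^ 3 * A := by
    calc ∫ y, max (v y - k) 0 ^ 3 ≤ ∫ y, (η * max (v y - k) 0 ^ 4 +
          (1 / η) ^ 3 * {y | k < v y}.indicator (fun _ => (1 : ℝ)) y) := by
          refine integral_mono (integrable_of_continuous (hwc.pow 3))
            (i1.add i2) fun y => ?_
          by_cases hy : k < v y
          · simp only [Set.indicator, Set.mem_ofPred_eq, hy, if_true, mul_one]
            rw [max_eq_left (by linarith)]
            set w := v y - k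
            have hw : 0 < w := by simp only [w]; linarith
            rcases le_total (1 / η) w with h | h
            · have : 1 ≤ η * w := by rwa [div_le_iff₀' hη0] at h
              have h5 : w ^ 3 ≤ (η * w) * w ^ 3 := le_mul_of_one_le_left (by positivity) this
              have : 0 ≤ (1 / η) ^ 3 := by positivity
              nlinarith
            · have : w ^ 3 ≤ (1 / η) ^ 3 := by gcongr
              have : 0 ≤ η * w ^ 4 := by positivity
              linarith
          · rw [max_eq_right (by linarith)]
            simp [hy]
      _ = η * Q + (1 / η) ^ 3 * volume.real {y | k < v y} := by
        rw [integral_add i1 i2, integral_const_mul,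
          integral_const_mul, integral_indicator hm]
        simp [Q]
      _ ≤ _ := by gcongr
  have h4 : (R : ℝ) ^ 2 * Q ≤ 8 * K * (η * Q + (1 / η) ^ 3 * A) := by
    calc (R : ℝ) ^ 2 * Q ≤ _ := hF
      _ ≤ 2 * (4 * (K * (η * Q + (1 / η) ^ 3 * A))) := by gcongr; exact hE.trans (by gcongr)
      _ = _ := by ring
  have e1 : 16 * K * η = R ^ 2 := by rw [hη]; field_simp
  have e2 : 16 * K / (R : ℝ) ^ 2 = 1 / η := by rw [hη]; field_simp
  rw [e2]
  have h5 : 16 * K * η * Q ≤ 16 * K * η * ((1 / η) ^ 4 * A) := by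
    have : 16 * K * η * ((1 / η) ^ 4 * A) = 2 * (8 * K * ((1 / η) ^ 3 * A)) := by
      field_simp
      ring
    rw [this]
    rw [← e1] at h4
    linarith
  exact le_of_mul_le_mul_left h5 (by positivity)

/-- The bound of De Giorgi's iteration. -/
noncomputable def deGiorgiBound (d : ℕ) (K L : ℝ) : ℝ := 2 * L * 3 ^ (d + 1) + 1 + 32 * K * 2 ^ (d + 1)

/-- The levels `k j` increase by geometrically decreasing steps and stay below the bound, while the
measures of `{v > k j}` are at most `a j → 0`. So the open set where `v` exceeds the bound is null,
hence empty. -/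
theorem le_deGiorgiBound {v : Torus d → ℝ}
    (hv : ContDiff ℝ 1 fun y : Fin d → ℝ => v (proj y)) {K L : ℝ} (hK : 0 < K)
    (hE : ∀ k, ∑ i, ∫ y, (max (v y - k) 0 * pderiv i v y) ^ 2 ≤ K * ∫ y, max (v y - k) 0 ^ 3)
    (hL : ∫ y, v y ^ 2 ≤ L) (y : Torus d) : v y ≤ deGiorgiBound d K L := by
  have hvc : Continuous v := continuous_of_comp_proj hv.continuous
  have hL0 : 0 ≤ L := (integral_nonneg fun y => sq_nonneg (v y)).trans hL
  set k0 := 2 * L * 3 ^ (d + 1) + 1 with hk0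
  have hk0' : 1 ≤ k0 := by rw [hk0]; have : 0 ≤ 2 * L * 3 ^ (d + 1) := by positivity
                           linarith
  set k : ℕ → ℝ := fun j => k0 + 16 * K * 2 ^ (d + 1) * ∑ i ∈ Finset.range j, (1 / 4 : ℝ) ^ i
  -- The measure `a j` allows the frequency cutoff `R = 2 ^ j`, since `2R + 1 ≤ 3 * 2 ^ j`. The
  -- exponent `d + 1` instead of `d` makes `a j` tend to zero also for `d = 0`.
  set a : ℕ → ℝ := fun j => 1 / 2 * (1 / (3 * 2 ^ j)) ^ (d + 1)
  have ha : ∀ j, 0 < a j := fun j => by positivity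
  have hiter : ∀ j, volume.real {y | k j < v y} ≤ a j := by
    intro j
    induction j with
    | zero =>
      -- The start is Chebyshev's inequality for `v²`; as `k0 ≥ 1`, one has `k0² ≥ k0 = 2 * 3 ^ (d +
      -- 1) * L + 1`.
      have h1 := mul_meas_ge_le_integral_of_nonneg (μ := (volume : Measure (Torus d)))
        (f := fun y => v y ^ 2) (Filter.Eventually.of_forall fun y => sq_nonneg _)
        (integrable_of_continuous (hvc.pow 2)) (k0 ^ 2)
      have h2 : volume.real {y | k 0 < v y} ≤ volume.real {y | k0 ^ 2 ≤ v y ^ 2} := by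
        refine measureReal_mono fun y hy => ?_
        have hy' : k0 < v y := by simpa [k] using hy
        simp only [Set.mem_ofPred_eq]
        gcongr
      have h3 : 2 * 3 ^ (d + 1) * L ≤ k0 ^ 2 := by nlinarith
      have h4 : k0 ^ 2 * volume.real {y | k 0 < v y} ≤ L :=
        (mul_le_mul_of_nonneg_left h2 (sq_nonneg _)).trans (h1.trans hL)
      have h5 : volume.real {y | k 0 < v y} ≤ 1 := measureReal_le_one
      have h6 : 0 ≤ volume.real {y | k 0 < v y} := measureReal_nonneg
      have h7 : a 0 = 1 / (2 * 3 ^ (d + 1)) := by simp [a, mul_comm]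
      rw [h7, le_div_iff₀ (by positivity)]
      set x := volume.real {y | k 0 < v y}
      have hk2 : 2 * 3 ^ (d + 1) * L + 1 ≤ k0 ^ 2 := by
        nlinarith [mul_nonneg hL0 (pow_nonneg (zero_le_three (α := ℝ)) (d + 1))]
      have hc : (0:ℝ) < 2 * 3 ^ (d + 1) := by positivity
      by_contra! hcon
      have : k0 ^ 2 * 1 < k0 ^ 2 * (x * (2 * 3 ^ (d + 1))) := by
        have : 0 < k0 ^ 2 := by positivity
        gcongr
      nlinarith [mul_le_mul_of_nonneg_left h4 hc.le]
    | succ j ih =>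
      have hRA : (2 * ((2 ^ j : ℕ) : ℝ) + 1) ^ d * a j ≤ 1 / 2 := by
        have h1 : (1 : ℝ) ≤ 2 ^ j := one_le_pow₀ one_le_two
        have h2 : (2 * ((2 ^ j : ℕ) : ℝ) + 1) ^ d ≤ (3 * 2 ^ j) ^ (d + 1) := by
          push_cast
          calc (2 * (2 : ℝ) ^ j + 1) ^ d ≤ (3 * 2 ^ j) ^ d := by gcongr; linarith
            _ ≤ (3 * 2 ^ j) ^ (d + 1) := pow_le_pow_right₀ (by linarith) (by omega)
        calc _ ≤ (3 * 2 ^ j) ^ (d + 1) * a j := by gcongr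
          _ = 1 / 2 := by simp only [a, div_pow, one_pow]; field_simp
      have h1 := integral_posPart_pow_four_le hv hK (k j) (hE _) (R := 2 ^ j) (by positivity)
        (ha j) ih hRA
      -- The factor `2 ^ (d + 1)` is the ratio `a j / a (j + 1)`; after the fourth power in
      -- Chebyshev's inequality it more than pays for passing to `a (j + 1)`.
      set s := 16 * K * 2 ^ (d + 1) * (1 / 4 : ℝ) ^ j with hs
      have hs0 : 0 < s := by positivity
      have hks : k (j + 1) = k j + s := by
        simp only [k, Finset.sum_range_succ, hs]; ring
      have h2 := mul_meas_ge_le_integral_of_nonneg (μ := (volume : Measure (Torus d)))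
        (f := fun y => max (v y - k j) 0 ^ 4)
        (Filter.Eventually.of_forall fun y => by positivity)
        (integrable_of_continuous (by fun_prop)) (s ^ 4)
      have h3 : volume.real {y | k (j + 1) < v y} ≤
          volume.real {y | s ^ 4 ≤ max (v y - k j) 0 ^ 4} := by
        refine measureReal_mono fun y hy => ?_
        simp only [Set.mem_ofPred_eq, hks] at hy ⊢
        gcongr
        exact le_max_of_le_left (by linarith)
      have h4 : s ^ 4 * volume.real {y | k (j + 1) < v y} ≤ s ^ 4 * a (j + 1) := by
        refine (mul_le_mul_of_nonneg_left h3 (by positivity)).trans (h2.trans (h1.trans ?_))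
        have e1 : 16 * K / ((2 ^ j : ℕ) : ℝ) ^ 2 = 16 * K * (1 / 4) ^ j := by
          push_cast
          rw [← pow_mul, mul_comm j 2, pow_mul]
          rw [one_div_pow]
          norm_num [div_eq_mul_inv]
        have e2 : s ^ 4 = (16 * K * (1 / 4) ^ j) ^ 4 * (2 ^ (d + 1)) ^ 4 := by rw [hs]; ring
        have e3 : a j = 2 ^ (d + 1) * a (j + 1) := by
          simp only [a, div_pow, one_pow, mul_pow]
          field_simp
          rw [← mul_pow, ← pow_succ]
        rw [e1, e2, e3, mul_assoc ((16 * K * (1 / 4 : ℝ) ^ j) ^ 4)]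
        have h5 : (2 : ℝ) ^ (d + 1) ≤ (2 ^ (d + 1)) ^ 4 :=
          le_self_pow₀ (one_le_pow₀ one_le_two) (by norm_num)
        have := (ha (j + 1)).le
        gcongr
      exact le_of_mul_le_mul_left h4 (by positivity)
  have hkM : ∀ j, k j ≤ deGiorgiBound d K L := fun j => by
    have h1 : ∑ i ∈ Finset.range j, (1 / 4 : ℝ) ^ i ≤ 2 := by
      have h2 := (summable_geometric_of_lt_one (r := (1 / 4 : ℝ)) (by norm_num)
        (by norm_num)).sum_le_tsum (Finset.range j) (fun i _ => by positivity)
      rw [tsum_geometric_of_lt_one (by norm_num) (by norm_num)] at h2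
      refine h2.trans (by norm_num)
    calc k j ≤ k0 + 16 * K * 2 ^ (d + 1) * 2 := by simp only [k]; gcongr
      _ = _ := by rw [deGiorgiBound, hk0]; ring
  have hM : volume.real {y | deGiorgiBound d K L < v y} ≤ 0 := by
    have hlim : Filter.Tendsto a Filter.atTop (nhds 0) := by
      have h1 : Filter.Tendsto (fun j : ℕ => 1 / 3 * (1 / 2 : ℝ) ^ j) Filter.atTop (nhds 0) := by
        have := (tendsto_pow_atTop_nhds_zero_of_lt_one (r := (1 / 2 : ℝ)) (by norm_num)
          (by norm_num)).const_mul (1 / 3)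
        rwa [mul_zero] at this
      have h2 := (h1.pow (d + 1)).const_mul (1 / 2)
      simp only [ne_eq, Nat.add_eq_zero_iff, one_ne_zero, and_false, not_false_eq_true, zero_pow,
        mul_zero] at h2
      refine h2.congr fun j => ?_
      simp only [a]
      congr 2
      rw [one_div_pow]; field_simp
    refine ge_of_tendsto' hlim fun j => (measureReal_mono fun y hy => ?_).trans (hiter j)
    exact (hkM j).trans_lt hy
  by_contra! hy
  have hopen : IsOpen {y | deGiorgiBound d K L < v y} := isOpen_lt continuous_const hvc
  have hpos := hopen.measure_pos volume ⟨y, hy⟩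
  have : 0 < volume.real {y | deGiorgiBound d K L < v y} :=
    ENNReal.toReal_pos hpos.ne' (measure_ne_top _ _)
  linarith

/-! ### Smooth families of continuous functions on the torus -/

section SmoothFamilies

universe u
variable {E F : Type u} [NormedAddCommGroup E] [NormedSpace ℝ E] [NormedAddCommGroup F]
  [NormedSpace ℝ F]

theorem continuous_uncurry_of_comp_proj {X G : Type*} [TopologicalSpace X] [TopologicalSpace G]
    {f : X → Torus d → G} (hf : Continuous fun p : X × (Fin d → ℝ) => f p.1 (proj p.2)) :
    Continuous (Function.uncurry f) :=
  (IsOpenQuotientMap.id.prodMap isOpenQuotientMap_proj).isQuotientMap.continuous_iff.2 hf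

/-- The family of continuous functions given by a jointly smooth function. -/
def family (f : E → Torus d → F)
    (hf : ContDiff ℝ ∞ fun p : E × (Fin d → ℝ) => f p.1 (proj p.2)) (x : E) : C(Torus d, F) :=
  ⟨f x, (continuous_uncurry_of_comp_proj hf.continuous).comp (Continuous.prodMk_right x)⟩

theorem continuous_family (f : E → Torus d → F)
    (hf : ContDiff ℝ ∞ fun p : E × (Fin d → ℝ) => f p.1 (proj p.2)) : Continuous (family f hf) :=
  ContinuousMap.continuous_of_continuous_uncurry _ (continuous_uncurry_of_comp_proj hf.continuous)

/-- A continuous family of linear maps, as a linear map into continuous functions. -/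
noncomputable def linFamily (d : ℕ) {E F G : Type*} [NormedAddCommGroup E] [NormedSpace ℝ E]
    [NormedAddCommGroup F] [NormedSpace ℝ F] [NormedAddCommGroup G] [NormedSpace ℝ G]
    (L : G →L[ℝ] E →L[ℝ] F) : C(Torus d, G) →L[ℝ] E →L[ℝ] C(Torus d, F) :=
  LinearMap.mkContinuous₂
    (LinearMap.mk₂ ℝ (fun (A : C(Torus d, G)) (v : E) =>
        (⟨fun k => L (A k) v, by fun_prop⟩ : C(Torus d, F)))
      (fun A B v => by ext; simp) (fun c A v => by ext; simp) (fun A v w => by ext; simp)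
      (fun c A v => by ext; simp)) ‖L‖ (fun A v => by
      rw [ContinuousMap.norm_le _ (by positivity)]
      intro k
      refine (L.le_opNorm₂ (A k) v).trans ?_
      gcongr
      exact A.norm_coe_le_norm k)

theorem linFamily_apply {G : Type*} [NormedAddCommGroup G] [NormedSpace ℝ G]
    (L : G →L[ℝ] E →L[ℝ] F) (A : C(Torus d, G)) (v : E) (k : Torus d) :
    linFamily d L A v k = L (A k) v := rfl

/-- Pointwise derivatives that vary continuously in the uniform norm give a derivative in the
uniform norm: the mean value inequality on a small ball is uniform in the point of the torus. -/
theorem hasFDerivAt_family {G : Type*} [NormedAddCommGroup G] [NormedSpace ℝ G]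
    (L : G →L[ℝ] E →L[ℝ] F) {Φ : E → C(Torus d, F)} {Ψ : E → C(Torus d, G)}
    (hΨ : Continuous Ψ) (h : ∀ x k, HasFDerivAt (fun x => Φ x k) (L (Ψ x k)) x) (x : E) :
    HasFDerivAt Φ (linFamily d L (Ψ x)) x := by
  rw [hasFDerivAt_iff_isLittleO, Asymptotics.isLittleO_iff]
  intro c hc
  have hlim : Filter.Tendsto (fun z => ‖L‖ * ‖Ψ z - Ψ x‖) (nhds x) (nhds 0) := by
    have : Continuous fun z => ‖L‖ * ‖Ψ z - Ψ x‖ := by fun_prop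
    simpa using this.tendsto x
  obtain ⟨δ, hδ, hball⟩ := Metric.mem_nhds_iff.1 (hlim (Iio_mem_nhds hc))
  filter_upwards [Metric.ball_mem_nhds x hδ] with z hz
  rw [ContinuousMap.norm_le _ (by positivity)]
  intro k
  have := (convex_ball x δ).norm_image_sub_le_of_norm_hasFDerivWithin_le' (C := c)
    (f := fun x => Φ x k) (f' := fun x => L (Ψ x k)) (φ := L (Ψ x k))
    (fun y _ => (h y k).hasFDerivWithinAt) (fun y hy => by
      rw [← map_sub]
      refine (L.le_opNorm _).trans (le_trans ?_ (Set.mem_Iio.1 (hball hy)).le)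
      exact mul_le_mul_of_nonneg_left ((Ψ y - Ψ x).norm_coe_le_norm k) (norm_nonneg _)) (Metric.mem_ball_self hδ) hz
  simpa [linFamily_apply] using this

theorem contDiff_succ_family {G : Type*} [NormedAddCommGroup G] [NormedSpace ℝ G]
    (L : G →L[ℝ] E →L[ℝ] F) {Φ : E → C(Torus d, F)} {Ψ : E → C(Torus d, G)} {n : ℕ}
    (hΨ : ContDiff ℝ n Ψ) (h : ∀ x k, HasFDerivAt (fun x => Φ x k) (L (Ψ x k)) x) :
    ContDiff ℝ (n + 1) Φ := by
  have hL : ContDiff ℝ n (linFamily d L) := by fun_prop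
  exact contDiff_succ_iff_hasFDerivAt.2 ⟨fun x => linFamily d L (Ψ x), hL.comp hΨ,
    hasFDerivAt_family L hΨ.continuous h⟩

theorem hasFDerivAt_fst {f : E → Torus d → F}
    (hf : ContDiff ℝ ∞ fun p : E × (Fin d → ℝ) => f p.1 (proj p.2)) (y : Fin d → ℝ) (x : E) :
    HasFDerivAt (fun x => f x (proj y))
      ((fderiv ℝ (fun p : E × (Fin d → ℝ) => f p.1 (proj p.2)) (x, y)).comp
        (ContinuousLinearMap.inl ℝ E (Fin d → ℝ))) x :=
  HasFDerivAt.comp (f := fun x => (x, y)) x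
    (hf.differentiable (by simp) (x, y)).hasFDerivAt (hasFDerivAt_prodMk_left x y)

/-- The induction runs over all target spaces, because the derivative takes values in `E →L[ℝ] F`;
the common universe of `E` and `F` keeps this space in the same universe. -/
theorem contDiff_nat_family (n : ℕ) : ∀ {F : Type u} [NormedAddCommGroup F] [NormedSpace ℝ F]
    (f : E → Torus d → F) (hf : ContDiff ℝ ∞ fun p : E × (Fin d → ℝ) => f p.1 (proj p.2)),
    ContDiff ℝ n (family f hf) := by
  induction n with
  | zero =>
    intro F _ _ f hf
    simp only [Nat.cast_zero, contDiff_zero]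
    exact continuous_family f hf
  | succ n ih =>
    intro F _ _ f hf
    have hs : ContDiff ℝ ∞ fun p : E × (Fin d → ℝ) =>
        (fun x k => fderiv ℝ (fun x => f x k) x) p.1 (proj p.2) := by
      simp_rw [fun (p : E × (Fin d → ℝ)) => (hasFDerivAt_fst hf p.2 p.1).fderiv]
      exact (hf.fderiv_right (m := ∞) (by simp)).clm_comp contDiff_const
    refine contDiff_succ_family (ContinuousLinearMap.id ℝ (E →L[ℝ] F)) (ih (fun x k => fderiv ℝ (fun x => f x k) x) hs) fun x k => ?_
    obtain ⟨y, rfl⟩ := proj_surjective k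
    exact (hasFDerivAt_fst hf y x).differentiableAt.hasFDerivAt

/-- A family of functions on the torus which is smooth jointly in the parameter and in the point
depends smoothly on the parameter, with respect to the uniform norm. -/
theorem contDiff_family {Φ : E → C(Torus d, F)}
    (h : ContDiff ℝ ∞ fun p : E × (Fin d → ℝ) => Φ p.1 (proj p.2)) : ContDiff ℝ ∞ Φ :=
  contDiff_infty.2 fun n => contDiff_nat_family n (fun x => Φ x) h

/-- The translate `φ(· + s)`. -/
def translate {G : Type*} [TopologicalSpace G] (s : Torus d) (φ : C(Torus d, G)) : C(Torus d, G) :=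
  ⟨fun y => φ (y + s), by fun_prop⟩

theorem contDiff_translate {E : Type} [NormedAddCommGroup E] [NormedSpace ℝ E]
    {Φ : E → C(Torus d, ℝ)}
    (h : ContDiff ℝ ∞ fun p : E × (Fin d → ℝ) => Φ p.1 (proj p.2)) :
    ContDiff ℝ ∞ fun p : E × (Fin d → ℝ) => translate (proj p.2) (Φ p.1) := by
  refine contDiff_family ?_
  have : ContDiff ℝ ∞ fun q : (E × (Fin d → ℝ)) × (Fin d → ℝ) => (q.1.1, q.2 + q.1.2) := by
    fun_prop
  have h2 := h.comp this
  simp only [Function.comp_def, proj_add] at h2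
  exact h2

end SmoothFamilies

/-! ### The Hilbert space of mean-zero functions in `H^1` -/

/-- `L^2(𝕋^d)`. -/
abbrev L2 (d : ℕ) : Type := Lp ℝ 2 (volume : Measure (Torus d))

/-- A continuous function as an element of `L^2`. -/
noncomputable def toL2 (d : ℕ) : C(Torus d, ℝ) →L[ℝ] L2 d := ContinuousMap.toLp 2 volume ℝ

theorem coeFn_toL2 (g : C(Torus d, ℝ)) : toL2 d g =ᵐ[volume] g :=
  ContinuousMap.coeFn_toLp (𝕜 := ℝ) volume g

/-- Multiplication of functions in `L^2` by continuous functions. -/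
noncomputable def mulL2 (d : ℕ) : C(Torus d, ℝ) →L[ℝ] L2 d →L[ℝ] L2 d :=
  ((ContinuousLinearMap.mul ℝ ℝ).holderL volume ⊤ 2 2).comp (ContinuousMap.toLp ⊤ volume ℝ)

theorem coeFn_mulL2 (a : C(Torus d, ℝ)) (f : L2 d) :
    mulL2 d a f =ᵐ[volume] fun y => a y * f y := by
  have h1 := (ContinuousLinearMap.mul ℝ ℝ).coeFn_holder (r := 2) (p := ⊤) (q := 2)
    (ContinuousMap.toLp ⊤ volume ℝ a) f
  filter_upwards [h1, ContinuousMap.coeFn_toLp (p := ⊤) (𝕜 := ℝ) (volume : Measure (Torus d)) a]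
    with y hy1 hy2
  refine hy1.trans ?_
  rw [hy2]; rfl

theorem inner_L2 (f g : L2 d) : inner ℝ f g = ∫ y, f y * g y := by
  rw [L2.inner_def]
  congr 1; ext y
  simp [mul_comm]

theorem inner_toL2 (g : C(Torus d, ℝ)) (f : L2 d) : inner ℝ (toL2 d g) f = ∫ y, g y * f y := by
  rw [inner_L2]
  refine integral_congr_ae ?_
  filter_upwards [coeFn_toL2 g] with y hy
  rw [hy]

theorem inner_mulL2 (a : C(Torus d, ℝ)) (f g : L2 d) :
    inner ℝ (mulL2 d a f) g = ∫ y, a y * f y * g y := by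
  rw [inner_L2]
  refine integral_congr_ae ?_
  filter_upwards [coeFn_mulL2 a f] with y hy
  rw [hy]

theorem MemH1.congr_ae {u v : Torus d → ℝ} {G H : Fin d → Torus d → ℝ} (h : MemH1 u G)
    (huv : u =ᵐ[volume] v) (hGH : ∀ i, G i =ᵐ[volume] H i) : MemH1 v H where
  memLp := h.memLp.ae_eq huv
  memLp_grad i := (h.memLp_grad i).ae_eq (hGH i)
  weak_grad i φ hφ := by
    refine (integral_congr_ae (huv.symm.mul (Filter.EventuallyEq.refl _ _))).trans
      ((h.weak_grad i φ hφ).trans (congrArg Neg.neg ?_))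
    exact integral_congr_ae ((hGH i).mul (Filter.EventuallyEq.refl _ _))

theorem MemH1.add {u v : Torus d → ℝ} {G H : Fin d → Torus d → ℝ} (hu : MemH1 u G)
    (hv : MemH1 v H) : MemH1 (fun y => u y + v y) fun i y => G i y + H i y where
  memLp := hu.memLp.add hv.memLp
  memLp_grad i := (hu.memLp_grad i).add (hv.memLp_grad i)
  weak_grad i φ hφ := by
    have c1 := continuous_of_comp_proj (ContDiff.continuous hφ)
    have c2 := continuous_of_comp_proj (ContDiff.continuous (hφ.pderiv i))
    simp_rw [add_mul]
    rw [integral_add (integrable_mul_continuous hu.memLp c2)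
      (integrable_mul_continuous hv.memLp c2),
      integral_add (integrable_mul_continuous (hu.memLp_grad i) c1)
      (integrable_mul_continuous (hv.memLp_grad i) c1), hu.weak_grad i φ hφ, hv.weak_grad i φ hφ]
    ring

theorem MemH1.const_mul {u : Torus d → ℝ} {G : Fin d → Torus d → ℝ} (hu : MemH1 u G) (c : ℝ) :
    MemH1 (fun y => c * u y) fun i y => c * G i y where
  memLp := hu.memLp.const_mul c
  memLp_grad i := (hu.memLp_grad i).const_mul c
  weak_grad i φ hφ := by
    simp_rw [mul_assoc, integral_const_mul]
    rw [hu.weak_grad i φ hφ]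
    ring

/-- The space of functions in `L^2` together with candidates for their gradients. -/
abbrev L2Jet (d : ℕ) : Type := PiLp 2 fun _ : Option (Fin d) => L2 d

/-- The subspace of functions in `H^1` of mean zero, together with their gradients. -/
noncomputable def H1Zero (d : ℕ) : Submodule ℝ (L2Jet d) where
  carrier := {v | MemH1 (v none) (fun i => v (some i)) ∧ ∫ y, v none y = 0}
  add_mem' := by
    rintro v w ⟨hv, hv0⟩ ⟨hw, hw0⟩
    have h := Lp.coeFn_add (v none) (w none)
    refine ⟨(hv.add hw).congr_ae h.symm fun i => (Lp.coeFn_add (v (some i)) (w (some i))).symm, ?_⟩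
    rw [PiLp.add_apply, integral_congr_ae h]
    refine (integral_add (hv.memLp.integrable one_le_two) (hw.memLp.integrable one_le_two)).trans ?_
    rw [hv0, hw0, add_zero]
  zero_mem' := by
    have h : ((0 : L2 d) : Torus d → ℝ) =ᵐ[volume] fun _ => 0 := Lp.coeFn_zero ℝ 2 volume
    refine ⟨(memH1_const 0).congr_ae h.symm fun i => h.symm, ?_⟩
    exact (integral_congr_ae h).trans (by simp)
  smul_mem' := by
    rintro c v ⟨hv, hv0⟩
    have h := Lp.coeFn_smul c (v none)
    refine ⟨(hv.const_mul c).congr_ae h.symm fun i => (Lp.coeFn_smul c (v (some i))).symm, ?_⟩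
    rw [PiLp.smul_apply, integral_congr_ae h]
    refine (integral_const_mul c _).trans ?_
    rw [hv0, mul_zero]

theorem mem_H1Zero {v : L2Jet d} :
    v ∈ H1Zero d ↔ MemH1 (v none) (fun i => v (some i)) ∧ ∫ y, v none y = 0 := Iff.rfl

/-- For each fixed test function, the weak gradient identity is an equality of two continuous
functionals on `L2Jet`, and so is the mean-zero condition. -/
theorem isClosed_H1Zero : IsClosed (H1Zero d : Set (L2Jet d)) := by
  have hset : (H1Zero d : Set (L2Jet d)) =
      (⋂ (i : Fin d) (φ : C(Torus d, ℝ)) (ψ : C(Torus d, ℝ)) (_ : IsSmoothTorus φ)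
        (_ : ∀ y, ψ y = pderiv i φ y),
        {v | inner ℝ (toL2 d ψ) (v none) = - inner ℝ (toL2 d φ) (v (some i))}) ∩
      {v | inner ℝ (toL2 d 1) (v none) = 0} := by
    ext v
    simp only [SetLike.mem_coe, mem_H1Zero, Set.mem_inter_iff, Set.mem_iInter, Set.mem_ofPred_eq,
      inner_toL2, ContinuousMap.one_apply, one_mul]
    refine and_congr_left' ⟨fun h i φ ψ hφ hψ => ?_, fun h => ⟨Lp.memLp _, fun i => Lp.memLp _,
      fun i φ hφ => ?_⟩⟩
    · have := h.weak_grad i φ hφ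
      simpa [hψ, mul_comm] using this
    · have := h i ⟨φ, continuous_of_comp_proj (ContDiff.continuous hφ)⟩
        ⟨pderiv i φ, continuous_of_comp_proj (ContDiff.continuous (hφ.pderiv i))⟩ hφ (fun _ => rfl)
      simpa [mul_comm] using this
  rw [hset]
  have hc : ∀ o : Option (Fin d), Continuous fun v : L2Jet d => v o := fun o =>
    (PiLp.proj (𝕜 := ℝ) 2 (fun _ : Option (Fin d) => L2 d) o).continuous
  refine IsClosed.inter ?_ ?_
  · refine isClosed_iInter fun i => isClosed_iInter fun φ => isClosed_iInter fun ψ =>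
      isClosed_iInter fun _ => isClosed_iInter fun _ => isClosed_eq ?_ ?_
    · exact continuous_const.inner (hc _)
    · exact (continuous_const.inner (hc _)).neg
  · exact isClosed_eq (continuous_const.inner (hc _)) continuous_const

instance : CompleteSpace (H1Zero d) := isClosed_H1Zero.completeSpace_coe

/-- The components of an element of `H1Zero`: the function, and its partial derivatives. -/
noncomputable def comp (o : Option (Fin d)) : H1Zero d →L[ℝ] L2 d :=
  (PiLp.proj (𝕜 := ℝ) 2 (fun _ : Option (Fin d) => L2 d) o).comp (H1Zero d).subtypeL

theorem memH1_comp (v : H1Zero d) : MemH1 (comp none v) fun i => comp (some i) v := v.2.1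

theorem integral_comp_none (v : H1Zero d) : ∫ y, comp none v y = 0 := v.2.2

theorem exists_H1Zero {u : Torus d → ℝ} {G : Fin d → Torus d → ℝ} (h : MemH1 u G)
    (h0 : ∫ y, u y = 0) :
    ∃ v : H1Zero d, comp none v =ᵐ[volume] u ∧ ∀ i, comp (some i) v =ᵐ[volume] G i := by
  let v : L2Jet d := WithLp.toLp 2 fun o => o.elim (h.memLp.toLp u) fun i => (h.memLp_grad i).toLp _
  have h1 : v none =ᵐ[volume] u := h.memLp.coeFn_toLp
  have h2 : ∀ i, v (some i) =ᵐ[volume] G i := fun i => (h.memLp_grad i).coeFn_toLp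
  refine ⟨⟨v, h.congr_ae h1.symm fun i => (h2 i).symm, ?_⟩, h1, h2⟩
  rw [integral_congr_ae h1, h0]

theorem norm_sq_L2 (f : L2 d) : ‖f‖ ^ 2 = ∫ y, f y ^ 2 := by
  rw [← real_inner_self_eq_norm_sq, inner_L2]
  simp_rw [sq]

theorem norm_sq_le (v : H1Zero d) : ‖v‖ ^ 2 ≤ 2 * ∑ i, ∫ y, comp (some i) v y ^ 2 := by
  have h1 : ‖v‖ ^ 2 = (∫ y, comp none v y ^ 2) + ∑ i, ∫ y, comp (some i) v y ^ 2 := by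
    change ‖(v : L2Jet d)‖ ^ 2 = _
    rw [PiLp.norm_sq_eq_of_L2, Fintype.sum_option]
    simp_rw [norm_sq_L2]
    rfl
  have h2 := (memH1_comp v).poincare (integral_comp_none v)
  linarith

/-- The operator of the bilinear form `(v, w) ↦ ∫ a ∇v · ∇w` on `H1Zero`. -/
noncomputable def formOp (a : Fin d → Fin d → C(Torus d, ℝ)) : H1Zero d →L[ℝ] H1Zero d :=
  ∑ i, ∑ j, (comp (some i)).adjoint.comp ((mulL2 d (a i j)).comp (comp (some j)))

theorem inner_formOp (a : Fin d → Fin d → C(Torus d, ℝ)) (v w : H1Zero d) :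
    inner ℝ (formOp a v) w =
      ∑ i, ∑ j, ∫ y, a i j y * comp (some j) v y * comp (some i) w y := by
  simp only [formOp, sum_apply, ContinuousLinearMap.comp_apply, sum_inner,
    ContinuousLinearMap.adjoint_inner_left, inner_mulL2]

theorem integrable_mul_mul (a : C(Torus d, ℝ)) {f g : Torus d → ℝ} (hf : MemLp f 2 volume)
    (hg : MemLp g 2 volume) : Integrable (fun y => a y * f y * g y) volume := by
  have h := (hf.integrable_mul hg).bdd_mul (c := ‖a‖) (f := a) a.continuous.aestronglyMeasurable
    (Filter.Eventually.of_forall fun y => a.norm_coe_le_norm y)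
  refine h.congr (Filter.Eventually.of_forall fun y => ?_)
  simp [mul_assoc]

/-- Uniform ellipticity of a matrix-valued function. -/
def IsElliptic (c : ℝ) (a : Fin d → Fin d → Torus d → ℝ) : Prop :=
  ∀ y, ∀ ξ : Fin d → ℝ, c * ∑ i, ξ i ^ 2 ≤ ∑ i, ∑ j, ξ i * a i j y * ξ j

theorem IsElliptic.integral_le {c : ℝ} {a : Fin d → Fin d → C(Torus d, ℝ)}
    (ha : IsElliptic c fun i j => a i j) {G : Fin d → Torus d → ℝ}
    (hG : ∀ i, MemLp (G i) 2 volume) :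
    c * ∑ i, ∫ y, G i y ^ 2 ≤ ∑ i, ∑ j, ∫ y, a i j y * G j y * G i y := by
  have h1 : ∀ i, Integrable (fun y => G i y ^ 2) volume := fun i => (hG i).integrable_sq
  have h2 : ∀ i j, Integrable (fun y => a i j y * G j y * G i y) volume := fun i j =>
    integrable_mul_mul _ (hG j) (hG i)
  rw [← integral_finsetSum _ fun i _ => h1 i, ← integral_const_mul]
  simp_rw [← integral_finsetSum Finset.univ fun j (_ : j ∈ Finset.univ) => h2 _ j]
  rw [← integral_finsetSum _ fun i _ => integrable_finsetSum _ fun j _ => h2 i j]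
  refine integral_mono ((integrable_finsetSum _ fun i _ => h1 i).const_mul c)
    (integrable_finsetSum _ fun i _ => integrable_finsetSum _ fun j _ => h2 i j) fun y => ?_
  refine (ha y fun i => G i y).trans_eq ?_
  refine Finset.sum_congr rfl fun i _ => Finset.sum_congr rfl fun j _ => ?_
  ring

/-- Ellipticity and Poincaré give coercivity with constant `c / 2`, so Lax-Milgram applies without
symmetry. Invertibility in the operator algebra is the form needed for smoothness of the inverse. -/
theorem isUnit_formOp {c : ℝ} (hc : 0 < c) {a : Fin d → Fin d → C(Torus d, ℝ)}
    (ha : IsElliptic c fun i j => a i j) : IsUnit (formOp a) := by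
  let B : H1Zero d →L[ℝ] H1Zero d →L[ℝ] ℝ := (innerSL ℝ).comp (formOp a)
  have hB : ∀ v w, B v w = inner ℝ (formOp a v) w := fun v w => rfl
  have hco : IsCoercive B := by
    refine ⟨c / 2, by positivity, fun v => ?_⟩
    rw [hB, inner_formOp]
    refine le_trans ?_ (ha.integral_le (memH1_comp v).memLp_grad)
    have := norm_sq_le v
    nlinarith
  have h : formOp a = (hco.continuousLinearEquivOfBilin : H1Zero d →L[ℝ] H1Zero d) := by
    ext1 v
    refine ext_inner_right ℝ fun w => ?_
    rw [← hB, ContinuousLinearEquiv.coe_coe, hco.continuousLinearEquivOfBilin_apply]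
  rw [h]
  exact ⟨ContinuousLinearEquiv.toUnit hco.continuousLinearEquivOfBilin, rfl⟩

/-- The weak solution of mean zero of `∇ · (a ∇ v) = g`, by the Lax-Milgram theorem. -/
noncomputable def weakSol (a : Fin d → Fin d → C(Torus d, ℝ)) (g : C(Torus d, ℝ)) : H1Zero d :=
  - Ring.inverse (formOp a) ((comp none).adjoint (toL2 d g))

theorem formOp_weakSol {c : ℝ} (hc : 0 < c) {a : Fin d → Fin d → C(Torus d, ℝ)}
    (ha : IsElliptic c fun i j => a i j) (g : C(Torus d, ℝ)) (w : H1Zero d) :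
    ∑ i, ∑ j, ∫ y, a i j y * comp (some j) (weakSol a g) y * comp (some i) w y =
      - ∫ y, g y * comp none w y := by
  have h := DFunLike.congr_fun (Ring.mul_inverse_cancel _ (isUnit_formOp hc ha))
    ((comp none).adjoint (toL2 d g))
  simp only [mul_apply_eq_comp, one_apply_eq_self] at h
  rw [← inner_formOp, weakSol, map_neg, h, inner_neg_left,
    ContinuousLinearMap.adjoint_inner_left, inner_toL2]

/-- The ellipticity constant may vary with the parameter: inversion is smooth near each unit, and
only invertibility at each point is used. -/
theorem contDiff_weakSol {E : Type*} [NormedAddCommGroup E] [NormedSpace ℝ E]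
    {a : E → Fin d → Fin d → C(Torus d, ℝ)} {g : E → C(Torus d, ℝ)}
    (ha : ∀ i j, ContDiff ℝ ∞ fun x => a x i j) (hg : ContDiff ℝ ∞ g)
    (hell : ∀ x, ∃ c > 0, IsElliptic c fun i j => a x i j) :
    ContDiff ℝ ∞ fun x => weakSol (a x) (g x) := by
  have h1 : ContDiff ℝ ∞ fun x => formOp (a x) := by
    refine ContDiff.sum fun i _ => ContDiff.sum fun j _ => ?_
    refine contDiff_const.clm_comp (ContDiff.clm_comp ?_ contDiff_const)
    exact (mulL2 d).contDiff.comp (ha i j)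
  have h2 : ContDiff ℝ ∞ fun x => Ring.inverse (formOp (a x)) := by
    rw [contDiff_iff_contDiffAt]
    intro x
    obtain ⟨c, hc, hx⟩ := hell x
    have h3 := isUnit_formOp hc hx
    have h4 := contDiffAt_ringInverse ℝ (n := ∞) (R := H1Zero d →L[ℝ] H1Zero d) h3.unit
    exact ContDiffAt.comp x h4 h1.contDiffAt
  refine (h2.clm_apply ?_).neg
  exact (comp none).adjoint.contDiff.comp ((toL2 d).contDiff.comp hg)

/-! ### Weak formulation with mean-zero test functions -/

/-- The weak form of `∇ · (a G) = g`, tested with mean-zero functions. -/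
def WeakForm (a : Fin d → Fin d → C(Torus d, ℝ)) (g : C(Torus d, ℝ))
    (G : Fin d → Torus d → ℝ) : Prop :=
  ∀ (w : Torus d → ℝ) (W : Fin d → Torus d → ℝ), MemH1 w W → ∫ y, w y = 0 →
    ∑ i, ∑ j, ∫ y, a i j y * G j y * W i y = - ∫ y, g y * w y

theorem weakForm_weakSol {c : ℝ} (hc : 0 < c) {a : Fin d → Fin d → C(Torus d, ℝ)}
    (ha : IsElliptic c fun i j => a i j) (g : C(Torus d, ℝ)) :
    WeakForm a g fun i => comp (some i) (weakSol a g) := by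
  intro w W hw hw0
  obtain ⟨v, hv, hV⟩ := exists_H1Zero hw hw0
  have h := formOp_weakSol hc ha g v
  have h1 : ∫ y, g y * comp none v y = ∫ y, g y * w y :=
    integral_congr_ae ((Filter.EventuallyEq.refl _ g).mul hv)
  rw [h1] at h
  rw [← h]
  refine Finset.sum_congr rfl fun i _ => Finset.sum_congr rfl fun j _ => ?_
  refine integral_congr_ae ?_
  filter_upwards [hV i] with y hy
  rw [hy]

theorem MemH1.sub_mean {u : Torus d → ℝ} {G : Fin d → Torus d → ℝ} (hu : MemH1 u G) :
    MemH1 (fun y => u y - ∫ z, u z) G ∧ ∫ y, (u y - ∫ z, u z) = 0 := by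
  refine ⟨by simpa using hu.sub (memH1_const (∫ z, u z)), ?_⟩
  rw [integral_sub (hu.memLp.integrable one_le_two) (integrable_const _)]
  simp

/-- Weak solutions are unique up to constants. -/
theorem WeakForm.unique {c : ℝ} (hc : 0 < c) {a : Fin d → Fin d → C(Torus d, ℝ)}
    (ha : IsElliptic c fun i j => a i j) {g : C(Torus d, ℝ)} {u v : Torus d → ℝ}
    {G H : Fin d → Torus d → ℝ} (hu : MemH1 u G) (hv : MemH1 v H) (hG : WeakForm a g G)
    (hH : WeakForm a g H) : ∃ m : ℝ, u =ᵐ[volume] fun y => v y + m := by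
  have hw := hu.sub hv
  obtain ⟨hw1, hw0⟩ := hw.sub_mean
  set m := ∫ y, (u y - v y)
  have e1 := hG _ _ hw1 hw0
  have e2 := hH _ _ hw1 hw0
  have e3 : ∑ i, ∑ j, ∫ y, a i j y * (G j y - H j y) * (G i y - H i y) = 0 := by
    have : ∀ i j, ∫ y, a i j y * (G j y - H j y) * (G i y - H i y) =
        (∫ y, a i j y * G j y * (G i y - H i y)) - ∫ y, a i j y * H j y * (G i y - H i y) := by
      intro i j
      rw [← integral_sub (integrable_mul_mul _ (hu.memLp_grad j) (hw.memLp_grad i))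
        (integrable_mul_mul _ (hv.memLp_grad j) (hw.memLp_grad i))]
      congr 1; ext y; ring
    simp_rw [this, Finset.sum_sub_distrib]
    rw [e1, e2, sub_self]
  have e4 := ha.integral_le hw.memLp_grad
  rw [e3] at e4
  have e5 := hw1.poincare hw0
  have e6 : ∫ y, (u y - v y - m) ^ 2 ≤ 0 := by nlinarith
  have e7 : (fun y => (u y - v y - m) ^ 2) =ᵐ[volume] 0 :=
    (integral_eq_zero_iff_of_nonneg (fun y => sq_nonneg _) hw1.memLp.integrable_sq).1
      (le_antisymm e6 (integral_nonneg fun y => sq_nonneg _))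
  refine ⟨m, ?_⟩
  filter_upwards [e7] with y hy
  have : u y - v y - m = 0 := by simpa using hy
  linarith

/-! ### Translations -/

theorem pderiv_translate (φ : Torus d → ℝ) (s : Torus d) (i : Fin d) (y : Torus d) :
    pderiv i (fun z => φ (z + s)) y = pderiv i φ (y + s) := by
  simp only [pderiv, add_right_comm]

theorem IsSmoothTorus.translate {φ : Torus d → ℝ} (hφ : IsSmoothTorus φ) (s : Torus d) :
    IsSmoothTorus fun y => φ (y + s) := by
  obtain ⟨t, rfl⟩ := proj_surjective s
  have h : ContDiff ℝ ∞ fun y : Fin d → ℝ => y + t := by fun_prop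
  have h2 := ContDiff.comp hφ h
  simp only [Function.comp_def, proj_add] at h2
  exact h2

theorem integral_translate {G : Type*} [NormedAddCommGroup G] [NormedSpace ℝ G] (f : Torus d → G)
    (s : Torus d) : ∫ y, f (y + s) = ∫ y, f y :=
  integral_add_right_eq_self (μ := volume) f s

theorem MemH1.translate {u : Torus d → ℝ} {G : Fin d → Torus d → ℝ} (hu : MemH1 u G)
    (s : Torus d) : MemH1 (fun y => u (y + s)) fun i y => G i (y + s) where
  memLp := hu.memLp.comp_measurePreserving (measurePreserving_add_right volume s)
  memLp_grad i := (hu.memLp_grad i).comp_measurePreserving (measurePreserving_add_right volume s)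
  weak_grad i φ hφ := by
    have h := hu.weak_grad i _ (hφ.translate (-s))
    simp_rw [pderiv_translate] at h
    rw [← integral_translate _ s, ← integral_translate (fun y => G i y * φ (y + -s)) s] at h
    simpa using h

theorem WeakForm.translate {a : Fin d → Fin d → C(Torus d, ℝ)} {g : C(Torus d, ℝ)}
    {G : Fin d → Torus d → ℝ} (h : WeakForm a g G) (s : Torus d) :
    WeakForm (fun i j => translate s (a i j)) (Multiscale.translate s g)
      fun i y => G i (y + s) := by
  intro w W hw hw0
  have h1 := h _ _ (hw.translate (-s)) (by rw [integral_translate w, hw0])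
  rw [← integral_translate (fun y => g y * w (y + -s)) s] at h1
  have h2 : ∀ i j, ∫ y, a i j y * G j y * W i (y + -s) =
      ∫ y, Multiscale.translate s (a i j) y * G j (y + s) * W i y := fun i j => by
    rw [← integral_translate _ s]
    simp [Multiscale.translate]
  simp_rw [h2] at h1
  simpa [Multiscale.translate] using h1

/-- Both sides solve the translated problem, so they differ by a constant, which vanishes because
both have mean zero. -/
theorem weakSol_translate {c : ℝ} (hc : 0 < c) {a : Fin d → Fin d → C(Torus d, ℝ)}
    (ha : IsElliptic c fun i j => a i j) (g : C(Torus d, ℝ)) (s : Torus d) :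
    comp none (weakSol (fun i j => translate s (a i j)) (translate s g)) =ᵐ[volume]
      fun y => comp none (weakSol a g) (y + s) := by
  have ha' : IsElliptic c fun i j => translate s (a i j) := fun y ξ => ha (y + s) ξ
  obtain ⟨m, hm⟩ := WeakForm.unique hc ha' (memH1_comp _) ((memH1_comp (weakSol a g)).translate s)
    (weakForm_weakSol hc ha' _) ((weakForm_weakSol hc ha g).translate s)
  have h0 := integral_comp_none (weakSol (fun i j => translate s (a i j)) (translate s g))
  rw [integral_congr_ae hm, integral_add
    (((memH1_comp (weakSol a g)).translate s).memLp.integrable one_le_two) (integrable_const _),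
    integral_translate, integral_comp_none] at h0
  have : m = 0 := by simpa using h0
  simpa [this] using hm

/-! ### Smooth orbits under translation consist of smooth functions -/

/-- The Fourier coefficient as a continuous functional on `L^2`. -/
noncomputable def coefL (n : Fin d → ℤ) : L2 d →L[ℝ] ℂ :=
  Complex.ofRealCLM.comp (innerSL ℝ (toL2 d ⟨fun y => (mFourier (-n) y).re, by fun_prop⟩)) +
  (Complex.I • Complex.ofRealCLM).comp
    (innerSL ℝ (toL2 d ⟨fun y => (mFourier (-n) y).im, by fun_prop⟩))

theorem coefL_apply (n : Fin d → ℤ) (f : L2 d) : coefL n f = fcoef n f := by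
  rw [fcoef_eq (Lp.memLp f)]
  simp [coefL, inner_toL2, mul_comm]

theorem norm_coefL_le (n : Fin d → ℤ) : ‖coefL n‖ ≤ 1 := by
  refine ContinuousLinearMap.opNorm_le_bound _ zero_le_one fun f => ?_
  rw [one_mul, coefL_apply]
  have h := (hasSum_sq_fcoef (Lp.memLp f)).summable.le_tsum n fun _ _ => sq_nonneg _
  rw [(hasSum_sq_fcoef (Lp.memLp f)).tsum_eq, ← norm_sq_L2] at h
  exact (sq_le_sq₀ (norm_nonneg _) (norm_nonneg _)).1 h

theorem fcoef_translate (f : Torus d → ℝ) (s : Torus d) (n : Fin d → ℤ) :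
    fcoef n (fun y => f (y + s)) = mFourier n s * fcoef n f := by
  rw [fcoef, fcoef, ← integral_translate (fun y => mFourier (-n) y * (f y : ℂ)) s,
    ← integral_const_mul]
  congr 1; ext y
  rw [mFourier_apply_add, mFourier_neg (x := s)]
  have h : mFourier n s * (starRingEnd ℂ) (mFourier n s) = 1 := by
    rw [Complex.mul_conj, Complex.normSq_eq_norm_sq, norm_mFourier_apply]; simp
  linear_combination (- mFourier (-n) y * f (y + s)) * h

theorem summable_prod_pi {g : ℤ → ℝ} (hg0 : ∀ n, 0 ≤ g n) (hg : Summable g) (d : ℕ) :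
    Summable fun n : Fin d → ℤ => ∏ i, g (n i) := by
  induction d with
  | zero => exact Summable.of_finite
  | succ d ih =>
    rw [← (Fin.consEquiv fun _ : Fin (d + 1) => ℤ).summable_iff]
    have h := hg.mul_of_nonneg ih hg0 fun n => Finset.prod_nonneg fun i _ => hg0 _
    refine h.congr fun p => ?_
    simp [Fin.prod_univ_succ, Fin.consEquiv]

/-- The weight by which `(1 - Δ)`-type operators act on Fourier coefficients. -/
noncomputable def weight (k : ℤ) : ℝ := 1 + (2 * Real.pi * k) ^ 2

theorem weight_pos (k : ℤ) : 0 < weight k := by unfold weight; positivity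

theorem summable_weight_inv : Summable fun k : ℤ => (weight k)⁻¹ := by
  have h := Real.summable_one_div_int_pow (p := 2).2 one_lt_two
  refine Summable.of_norm_bounded_eventually h ?_
  filter_upwards [Filter.eventually_cofinite_ne (0 : ℤ)] with k hk
  rw [Real.norm_of_nonneg (inv_nonneg.2 (weight_pos k).le), ← one_div]
  have hk2 : (0 : ℝ) < (k : ℝ) ^ 2 := by positivity
  refine one_div_le_one_div_of_le hk2 ?_
  have := one_le_two_pi_sq
  unfold weight
  rw [mul_pow]
  nlinarith

section Embedding

variable {E : Type*} [NormedAddCommGroup E] [NormedSpace ℝ E]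

/-- A continuous functional commutes with differentiation, so only the character is differentiated.
The result has the same shape with a new `κ`, which allows iteration. -/
theorem coefL_fderiv {Q : E × (Fin d → ℝ) → L2 d} (hQ : Differentiable ℝ Q) {n : Fin d → ℤ}
    {κ : E → ℂ} (h : ∀ x t, coefL n (Q (x, t)) = κ x * mFourier n (proj t)) (i : Fin d) (x : E)
    (t : Fin d → ℝ) :
    coefL n (fderiv ℝ Q (x, t) (0, Pi.single i 1)) =
      2 * Real.pi * Complex.I * n i * κ x * mFourier n (proj t) := by
  have h1 : HasDerivAt (fun τ : ℝ => (x, t + Pi.single i τ)) ((0 : E), Pi.single i (1 : ℝ)) 0 := by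
    refine (hasDerivAt_const _ _).prodMk ?_
    have h2 : HasDerivAt (fun τ : ℝ => t + τ • (Pi.single i 1 : Fin d → ℝ)) (Pi.single i 1) 0 := by
      simpa using ((hasDerivAt_id (0 : ℝ)).smul_const (Pi.single i 1 : Fin d → ℝ)).const_add t
    refine h2.congr_of_eventuallyEq (Filter.Eventually.of_forall fun τ => ?_)
    simp only [← Pi.single_smul, smul_eq_mul, mul_one]
  have h0 : (x, t) = (x, t + Pi.single i (0 : ℝ)) := by simp
  have h3 : HasDerivAt (fun τ : ℝ => coefL n (Q (x, t + Pi.single i τ)))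
      (coefL n (fderiv ℝ Q (x, t) (0, Pi.single i 1))) 0 := by
    refine (coefL n).hasFDerivAt.comp_hasDerivAt (0 : ℝ) ?_
    rw [h0]
    exact (hQ _).hasFDerivAt.comp_hasDerivAt (0 : ℝ) h1
  simp_rw [h, proj_add, proj_single] at h3
  have h4 := (hasDerivAt_mFourier_single n i (proj t)).const_mul (κ x)
  rw [h3.unique h4]
  ring

/-- Apply `1 - ∂_i²` in the orbit variable for each `i ∈ s`. A product weight is used because
summability of its inverse reduces to one dimension. -/
theorem exists_weighted {F : E × (Fin d → ℝ) → L2 d} (hF : ContDiff ℝ ∞ F)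
    (hτ : ∀ x t, F (x, t) =ᵐ[volume] fun y => F (x, 0) (y + proj t)) (s : Finset (Fin d)) :
    ∃ P : E × (Fin d → ℝ) → L2 d, ContDiff ℝ ∞ P ∧ ∀ n x t, coefL n (P (x, t)) =
      (∏ i ∈ s, weight (n i) : ℝ) * fcoef n (F (x, 0)) * mFourier n (proj t) := by
  classical
  induction s using Finset.induction_on with
  | empty =>
    refine ⟨F, hF, fun n x t => ?_⟩
    have h : fcoef n (F (x, t)) = fcoef n fun y => F (x, 0) (y + proj t) :=
      integral_congr_ae (by filter_upwards [hτ x t] with y hy; rw [hy])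
    rw [coefL_apply, h, fcoef_translate]
    simp [mul_comm]
  | insert i s hi ih =>
    obtain ⟨P, hP, hPn⟩ := ih
    let D : (E × (Fin d → ℝ) → L2 d) → E × (Fin d → ℝ) → L2 d := fun Q z =>
      fderiv ℝ Q z (0, Pi.single i 1)
    have hD : ∀ Q, ContDiff ℝ ∞ Q → ContDiff ℝ ∞ (D Q) := fun Q hQ =>
      (hQ.fderiv_right (m := ∞) (by simp)).clm_apply contDiff_const
    refine ⟨fun z => P z - D (D P) z, hP.sub (hD _ (hD _ hP)), fun n x t => ?_⟩
    have h1 := fun x t => coefL_fderiv (hP.differentiable (by simp))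
      (κ := fun x => (∏ i ∈ s, weight (n i) : ℝ) * fcoef n (F (x, 0))) (hPn n) i x t
    have h2 := coefL_fderiv ((hD _ hP).differentiable (by simp)) h1 i x t
    rw [map_sub, hPn]
    refine (congrArg _ h2).trans ?_
    rw [Finset.prod_insert hi, weight]
    push_cast
    linear_combination (- (2 * Real.pi * n i) ^ 2 *
      ((∏ i ∈ s, (weight (n i) : ℂ)) * fcoef n (F (x, 0))) * mFourier n (proj t)) * Complex.I_sq

/-- If the orbit under translations of a family in `L^2` is smooth, then the family is given by
a jointly smooth function. -/
theorem exists_smooth_of_orbit {F : E × (Fin d → ℝ) → L2 d} (hF : ContDiff ℝ ∞ F)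
    (hτ : ∀ x t, F (x, t) =ᵐ[volume] fun y => F (x, 0) (y + proj t)) :
    (ContDiff ℝ ∞ fun p : E × (Fin d → ℝ) =>
      (∑' n, fcoef n (F (p.1, 0)) * mFourier n (proj p.2)).re) ∧
    ∀ x, F (x, 0) =ᵐ[volume] fun y => (∑' n, fcoef n (F (x, 0)) * mFourier n y).re := by
  obtain ⟨P, hP, hPn⟩ := exists_weighted hF hτ Finset.univ
  have hw0 : ∀ n : Fin d → ℤ, 0 < ∏ i, weight (n i) := fun n =>
    Finset.prod_pos fun i _ => weight_pos _
  have hw : Summable fun n : Fin d → ℤ => (∏ i, weight (n i))⁻¹ := by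
    simp_rw [← Finset.prod_inv_distrib]
    exact summable_prod_pi (fun k => inv_nonneg.2 (weight_pos k).le) summable_weight_inv d
  have hK : Summable fun n : Fin d → ℤ => (∏ i, weight (n i))⁻¹ • coefL n := by
    refine Summable.of_norm_bounded hw fun n => ?_
    rw [norm_smul, Real.norm_of_nonneg (inv_nonneg.2 (hw0 n).le)]
    exact mul_le_of_le_one_right (inv_nonneg.2 (hw0 n).le) (norm_coefL_le n)
  -- Evaluating `K` on `P` cancels the weights and yields the Fourier series. Since `K` is one fixed
  -- continuous linear map, joint smoothness is inherited from `P` without termwise differentiation.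
  set K : L2 d →L[ℝ] ℂ := ∑' n : Fin d → ℤ, (∏ i, weight (n i))⁻¹ • coefL n
  have hKP : ∀ x t, HasSum (fun n => fcoef n (F (x, 0)) * mFourier n (proj t)) (K (P (x, t))) := by
    intro x t
    have h := (ContinuousLinearMap.apply ℝ ℂ (P (x, t))).hasSum hK.hasSum
    refine h.congr_fun fun n => ?_
    have hne : ((∏ i, weight (n i) : ℝ) : ℂ) ≠ 0 := by exact_mod_cast (hw0 n).ne'
    simp only [ContinuousLinearMap.apply_apply, smul_apply, hPn,
      Complex.real_smul, Complex.ofReal_inv]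
    field_simp
  constructor
  · simp_rw [fun (p : E × (Fin d → ℝ)) => (hKP p.1 p.2).tsum_eq]
    exact Complex.reCLM.contDiff.comp (K.contDiff.comp hP)
  · intro x
    refine ae_eq_tsum_fcoef (Lp.memLp _) ?_
    have h := (hKP x 0).summable
    simpa [mFourier_proj] using h

end Embedding

/-! ### Smooth weak solutions -/

theorem WeakForm.congr {a : Fin d → Fin d → C(Torus d, ℝ)} {g : C(Torus d, ℝ)}
    {G H : Fin d → Torus d → ℝ} (h : WeakForm a g G) (hGH : ∀ i, G i =ᵐ[volume] H i) :
    WeakForm a g H := by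
  intro w W hw hw0
  rw [← h w W hw hw0]
  refine Finset.sum_congr rfl fun i _ => Finset.sum_congr rfl fun j _ => ?_
  refine integral_congr_ae ?_
  filter_upwards [hGH j] with y hy
  rw [hy]

/-- Subtracting its mean from the test function changes neither its gradient nor, as `∫ g = 0`, the
right side. -/
theorem WeakForm.apply {a : Fin d → Fin d → C(Torus d, ℝ)} {g : C(Torus d, ℝ)}
    {G : Fin d → Torus d → ℝ} (h : WeakForm a g G) (hg : ∫ y, g y = 0) {w : Torus d → ℝ}
    {W : Fin d → Torus d → ℝ} (hw : MemH1 w W) :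
    ∑ i, ∑ j, ∫ y, a i j y * G j y * W i y = - ∫ y, g y * w y := by
  rw [h _ W hw.sub_mean.1 hw.sub_mean.2]
  simp_rw [mul_sub]
  have h1 : Integrable (fun y => g y * w y) volume :=
    (memLp_of_continuous g.continuous).integrable_mul hw.memLp
  rw [integral_sub h1 ((integrable_of_continuous g.continuous).mul_const _), integral_mul_const, hg]
  simp

theorem WeakForm.neg {a : Fin d → Fin d → C(Torus d, ℝ)} {g : C(Torus d, ℝ)}
    {G : Fin d → Torus d → ℝ} (h : WeakForm a g G) : WeakForm a (-g) fun i y => - G i y := by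
  intro w W hw hw0
  have := h w W hw hw0
  simp only [mul_neg, neg_mul, integral_neg, ContinuousMap.coe_neg, Pi.neg_apply,
    Finset.sum_neg_distrib, this]

theorem pderiv_neg (φ : Torus d → ℝ) (i : Fin d) (y : Torus d) :
    pderiv i (fun z => - φ z) y = - pderiv i φ y := by
  simp only [pderiv, deriv.fun_neg]

/-- A smooth weak solution is a classical solution. -/
theorem WeakForm.classical {a : Fin d → Fin d → C(Torus d, ℝ)} {g : C(Torus d, ℝ)}
    (ha : ∀ i j, IsSmoothTorus (a i j)) {v : Torus d → ℝ} (hv : IsSmoothTorus v)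
    (h : WeakForm a g fun i => pderiv i v) (hg : ∫ y, g y = 0) (y : Torus d) :
    ∑ i, pderiv i (fun z => ∑ j, a i j z * pderiv j v z) y = g y := by
  have hflux : ∀ i, IsSmoothTorus fun z => ∑ j, a i j z * pderiv j v z := fun i =>
    ContDiff.sum fun j _ => (ha i j).mul (hv.pderiv j)
  have hc : Continuous fun y => ∑ i, pderiv i (fun z => ∑ j, a i j z * pderiv j v z) y :=
    continuous_finsetSum _ fun i _ => continuous_of_comp_proj ((hflux i).pderiv i).continuous
  have hvc : ∀ j, Continuous (pderiv j v) := fun j =>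
    continuous_of_comp_proj (hv.pderiv j).continuous
  have hae : (fun y => (∑ i, pderiv i (fun z => ∑ j, a i j z * pderiv j v z) y) - g y)
      =ᵐ[volume] 0 := by
    refine ae_eq_zero_of_forall_smooth (memLp_of_continuous (hc.sub g.continuous)) fun φ hφ => ?_
    have hφc : Continuous φ := continuous_of_comp_proj hφ.continuous
    have hφc' : ∀ i, Continuous (pderiv i φ) := fun i =>
      continuous_of_comp_proj (hφ.pderiv i).continuous
    have h1 := h.apply hg (memH1_of_contDiff hφ.contDiff_one)
    have h2 : ∀ i, ∑ j, ∫ y, a i j y * pderiv j v y * pderiv i φ y =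
        - ∫ y, pderiv i (fun z => ∑ j, a i j z * pderiv j v z) y * φ y := fun i => by
      have i0 : ∀ j, Integrable (fun y => a i j y * pderiv j v y * pderiv i φ y) volume :=
        fun j => integrable_of_continuous (((a i j).continuous.mul (hvc j)).mul (hφc' i))
      rw [← integral_mul_pderiv (hflux i).contDiff_one hφ.contDiff_one i,
        ← integral_finsetSum _ fun j _ => i0 j]
      congr 1; ext y
      rw [Finset.sum_mul]
    simp_rw [h2, Finset.sum_neg_distrib] at h1
    have i1 : ∀ i, Integrable
        (fun y => pderiv i (fun z => ∑ j, a i j z * pderiv j v z) y * φ y) volume := fun i =>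
      integrable_of_continuous ((continuous_of_comp_proj ((hflux i).pderiv i).continuous).mul hφc)
    have i2 : Integrable (fun y => g y * φ y) volume :=
      integrable_of_continuous (g.continuous.mul hφc)
    simp_rw [sub_mul, Finset.sum_mul]
    rw [integral_sub (integrable_finsetSum _ fun i _ => i1 i) i2, integral_finsetSum _ fun i _ => i1 i]
    linarith
  have h3 := (Continuous.ae_eq_iff_eq volume (hc.sub g.continuous) continuous_zero).1 hae
  have h4 := congrFun h3 y
  simpa [sub_eq_zero] using h4

/-- The energy estimate. -/
theorem WeakForm.energy {c H : ℝ} (hc : 0 < c) {a : Fin d → Fin d → C(Torus d, ℝ)}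
    (ha : IsElliptic c fun i j => a i j) {g : C(Torus d, ℝ)} (hH : ∀ y, |g y| ≤ H)
    {v : Torus d → ℝ} (hv : IsSmoothTorus v) (h : WeakForm a g fun i => pderiv i v)
    (hv0 : ∫ y, v y = 0) : ∫ y, v y ^ 2 ≤ (H / c) ^ 2 := by
  have hvc : Continuous v := continuous_of_comp_proj hv.continuous
  have hm := memH1_of_contDiff hv.contDiff_one
  have h1 := h _ _ hm hv0
  have h2 := ha.integral_le hm.memLp_grad
  rw [h1] at h2
  have h3 := hm.poincare hv0
  have h4 : - ∫ y, g y * v y ≤ c / 2 * (∫ y, v y ^ 2) + H ^ 2 / (2 * c) := by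
    rw [← integral_neg]
    have i1 : Integrable (fun y => c / 2 * v y ^ 2) volume :=
      (integrable_of_continuous (hvc.pow 2)).const_mul _
    calc ∫ y, -(g y * v y) ≤ ∫ y, (c / 2 * v y ^ 2 + H ^ 2 / (2 * c)) := by
          refine integral_mono (integrable_of_continuous (g.continuous.mul hvc)).neg
            (i1.add (integrable_const _)) fun y => ?_
          have e1 : -(g y * v y) ≤ H * |v y| := by
            refine (neg_le_abs _).trans ?_
            rw [abs_mul]
            exact mul_le_mul_of_nonneg_right (hH y) (abs_nonneg _)
          -- Young's inequality as a completed square, weighted so that half of the coercive term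
          -- survives.
          have e2 : c / 2 * v y ^ 2 + H ^ 2 / (2 * c) - H * |v y| =
              c / 2 * (|v y| - H / c) ^ 2 := by
            rw [← sq_abs (v y)]; field_simp; ring
          have e3 : 0 ≤ c / 2 * (|v y| - H / c) ^ 2 := by positivity
          linarith
      _ = _ := by
          rw [integral_add i1 (integrable_const _), integral_const_mul]
          simp
  have h5 : c / 2 * (∫ y, v y ^ 2) ≤ c / 2 * (H / c) ^ 2 := by
    have : c / 2 * (H / c) ^ 2 = H ^ 2 / (2 * c) := by field_simp
    rw [this]
    nlinarith
  exact le_of_mul_le_mul_left h5 (by positivity)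

/-- Testing with `(v - k)₊³`, whose gradient is `3 (v - k)₊² ∇v`, produces the quadratic form at `(v
- k)₊ ∇v`, which is the hypothesis of `le_deGiorgiBound`. The `1` in `(H + 1) / c` keeps that
constant positive when `H = 0`. -/
theorem WeakForm.le_bound {c H : ℝ} (hc : 0 < c) {a : Fin d → Fin d → C(Torus d, ℝ)}
    (ha : IsElliptic c fun i j => a i j) {g : C(Torus d, ℝ)} (hH : ∀ y, |g y| ≤ H)
    (hg : ∫ y, g y = 0) {v : Torus d → ℝ} (hv : IsSmoothTorus v)
    (h : WeakForm a g fun i => pderiv i v) (hv0 : ∫ y, v y = 0) (y : Torus d) :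
    v y ≤ deGiorgiBound d ((H + 1) / c) ((H / c) ^ 2) := by
  have hH0 : 0 ≤ H := (abs_nonneg _).trans (hH 0)
  have hvc : Continuous v := continuous_of_comp_proj hv.continuous
  have hvc' : ∀ j, Continuous (pderiv j v) := fun j =>
    continuous_of_comp_proj (hv.pderiv j).continuous
  refine le_deGiorgiBound hv.contDiff_one (by positivity) (fun k => ?_)
    (h.energy hc ha hH hv hv0) y
  have hwc : Continuous fun y => max (v y - k) 0 := by fun_prop
  have hw := memH1_of_contDiff (φ := fun y => max (v y - k) 0 ^ 3)
    ((contDiff_posPart_pow k 1).comp hv.contDiff_one)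
  have h1 := h.apply hg hw
  have h2 : ∀ i j, ∫ y, a i j y * pderiv j v y * pderiv i (fun y => max (v y - k) 0 ^ 3) y =
      3 * ∫ y, a i j y * (max (v y - k) 0 * pderiv j v y) * (max (v y - k) 0 * pderiv i v y) :=
    fun i j => by
      rw [← integral_const_mul]
      congr 1; ext y
      rw [pderiv_comp (g := fun s => max (s - k) 0 ^ 3) (hasDerivAt_posPart_pow k 1)
        (hv.contDiff_one.differentiable one_ne_zero)]
      push_cast
      ring
  simp_rw [h2, ← Finset.mul_sum] at h1
  have h3 := ha.integral_le (G := fun i y => max (v y - k) 0 * pderiv i v y) fun i =>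
    memLp_of_continuous (hwc.mul (hvc' i))
  have h4 : - ∫ y, g y * max (v y - k) 0 ^ 3 ≤ H * ∫ y, max (v y - k) 0 ^ 3 := by
    rw [← integral_neg, ← integral_const_mul]
    refine integral_mono (integrable_of_continuous (g.continuous.mul (hwc.pow 3))).neg
      ((integrable_of_continuous (hwc.pow 3)).const_mul _) fun y => ?_
    have : 0 ≤ max (v y - k) 0 ^ 3 := by positivity
    have e := (neg_le_abs (g y)).trans (hH y)
    simp only
    nlinarith
  have h5 : 0 ≤ ∫ y, max (v y - k) 0 ^ 3 := integral_nonneg fun y => by positivity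
  have h6 : 0 ≤ ∑ i, ∫ y, (max (v y - k) 0 * pderiv i v y) ^ 2 :=
    Finset.sum_nonneg fun i _ => integral_nonneg fun y => sq_nonneg _
  rw [div_mul_eq_mul_div, le_div_iff₀ hc]
  have h7 : 0 ≤ H * ∫ y, max (v y - k) 0 ^ 3 := mul_nonneg hH0 h5
  nlinarith

theorem WeakForm.abs_le_bound {c H : ℝ} (hc : 0 < c) {a : Fin d → Fin d → C(Torus d, ℝ)}
    (ha : IsElliptic c fun i j => a i j) {g : C(Torus d, ℝ)} (hH : ∀ y, |g y| ≤ H)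
    (hg : ∫ y, g y = 0) {v : Torus d → ℝ} (hv : IsSmoothTorus v)
    (h : WeakForm a g fun i => pderiv i v) (hv0 : ∫ y, v y = 0) (y : Torus d) :
    |v y| ≤ deGiorgiBound d ((H + 1) / c) ((H / c) ^ 2) := by
  refine abs_le'.2 ⟨h.le_bound hc ha hH hg hv hv0 y, ?_⟩
  refine WeakForm.le_bound (g := -g) (v := fun y => - v y) hc ha (fun y => by simpa using hH y)
    (by simp [integral_neg, hg]) hv.neg ?_ (by simp [integral_neg, hv0]) y
  exact h.neg.congr fun i => Filter.Eventually.of_forall fun y => (pderiv_neg v i y).symm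

/-! ### Comparison with the formulation with a density -/

theorem integral_density_form {ρ : C(Torus d, ℝ)} {D : Torus d → Matrix (Fin d) (Fin d) ℝ}
    {a : Fin d → Fin d → C(Torus d, ℝ)} (haD : ∀ i j y, a i j y = ρ y * D y i j)
    {G W : Fin d → Torus d → ℝ} (hG : ∀ i, MemLp (G i) 2 volume)
    (hW : ∀ i, MemLp (W i) 2 volume) :
    ∫ y, ρ y * ∑ i, (∑ j, D y i j * G j y) * W i y =
      ∑ i, ∑ j, ∫ y, a i j y * G j y * W i y := by
  have h2 : ∀ i j, Integrable (fun y => a i j y * G j y * W i y) volume := fun i j =>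
    integrable_mul_mul _ (hG j) (hW i)
  simp_rw [← integral_finsetSum Finset.univ fun j (_ : j ∈ Finset.univ) => h2 _ j]
  rw [← integral_finsetSum _ fun i _ => integrable_finsetSum _ fun j _ => h2 i j]
  congr 1; ext y
  rw [Finset.mul_sum]
  refine Finset.sum_congr rfl fun i _ => ?_
  rw [Finset.sum_mul, Finset.mul_sum]
  refine Finset.sum_congr rfl fun j _ => ?_
  rw [haD]; ring

/-! ### Families on the multiscale space -/

/-- The point of `𝕏_m` with a given lift. -/
def point (x : (Fin d → ℝ) × (Fin m → Fin d → ℝ)) : Scales d m := (x.1, fun j => proj (x.2 j))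

theorem point_surjective : Function.Surjective (point : _ → Scales d m) := by
  rintro ⟨x0, x⟩
  choose t ht using fun j => proj_surjective (x j)
  exact ⟨(x0, t), by simp [point, ht]⟩

theorem isSmooth_iff {f : Scales d m → Torus d → ℝ} :
    IsSmooth f ↔ ContDiff ℝ ∞ fun p : ((Fin d → ℝ) × (Fin m → Fin d → ℝ)) × (Fin d → ℝ) =>
      f (point p.1) (proj p.2) := by
  constructor
  · intro h
    have : ContDiff ℝ ∞ fun p : ((Fin d → ℝ) × (Fin m → Fin d → ℝ)) × (Fin d → ℝ) =>
      (p.1.1, p.1.2, p.2) := by fun_prop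
    exact ContDiff.comp h this
  · intro h
    have : ContDiff ℝ ∞ fun p : (Fin d → ℝ) × (Fin m → Fin d → ℝ) × (Fin d → ℝ) =>
      ((p.1, p.2.1), p.2.2) := by fun_prop
    exact ContDiff.comp h this

theorem IsSmooth.isSmoothTorus {f : Scales d m → Torus d → ℝ} (h : IsSmooth f) (x : Scales d m) :
    IsSmoothTorus (f x) := by
  obtain ⟨x, rfl⟩ := point_surjective x
  have : ContDiff ℝ ∞ fun y : Fin d → ℝ => (x, y) := by fun_prop
  exact (isSmooth_iff.1 h).comp this

/-- The members of a smooth family, as continuous functions. -/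
def IsSmooth.toC {f : Scales d m → Torus d → ℝ} (h : IsSmooth f) (x : Scales d m) :
    C(Torus d, ℝ) :=
  ⟨f x, continuous_of_comp_proj (h.isSmoothTorus x).continuous⟩

theorem exists_proj_mem (y : Torus d) : ∃ t : Fin d → ℝ, (∀ i, t i ∈ Set.Ico (0 : ℝ) 1) ∧
    proj t = y := by
  have h : ∀ i, ∃ t ∈ Set.Ico (0 : ℝ) 1, (t : UnitAddCircle) = y i := fun i => by
    have := AddCircle.coe_image_Ico_eq (1 : ℝ) 0
    have h2 : y i ∈ ((↑) : ℝ → AddCircle (1 : ℝ)) '' Set.Ico 0 (0 + 1) := by rw [this]; trivial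
    simpa using h2
  choose t ht using h
  exact ⟨t, fun i => (ht i).1, funext fun i => (ht i).2⟩

/-- Any two points of the torus have lifts in the unit cube, at sup-distance at most one, so the
bound on the first derivative bounds the oscillation. -/
theorem HasBoundedDerivatives.exists_osc_le {h : Scales d m → Torus d → ℝ} (hs : IsSmooth h)
    (hb : HasBoundedDerivatives h) : ∃ C : ℝ, ∀ x y z, h x y ≤ h x z + C := by
  obtain ⟨C, hC⟩ := hb 1 le_rfl
  have hC0 : 0 ≤ C := (norm_nonneg _).trans (hC 0)
  refine ⟨C, fun x y z => ?_⟩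
  obtain ⟨x, rfl⟩ := point_surjective x
  obtain ⟨s, hs1, rfl⟩ := exists_proj_mem y
  obtain ⟨t, ht1, rfl⟩ := exists_proj_mem z
  have h1 := convex_univ.norm_image_sub_le_of_norm_fderiv_le (𝕜 := ℝ) (f := lift h) (C := C)
    (x := (x.1, x.2, t)) (y := (x.1, x.2, s))
    (fun p _ => (ContDiff.differentiable hs (by simp)) p)
    (fun p _ => by rw [← norm_iteratedFDeriv_one]; exact hC p) (Set.mem_univ _) (Set.mem_univ _)
  have h2 : ‖((x.1, x.2, s) : (Fin d → ℝ) × (Fin m → Fin d → ℝ) × (Fin d → ℝ)) -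
      (x.1, x.2, t)‖ ≤ 1 := by
    simp only [Prod.mk_sub_mk, sub_self, Prod.norm_mk, norm_zero]
    refine max_le zero_le_one (max_le zero_le_one ?_)
    refine (pi_norm_le_iff_of_nonneg zero_le_one).2 fun i => ?_
    rw [Pi.sub_apply, Real.norm_eq_abs, abs_le]
    have := hs1 i; have := ht1 i
    simp only [Set.mem_Ico] at *
    constructor <;> linarith
  have h3 : lift h (x.1, x.2, s) - lift h (x.1, x.2, t) ≤ C :=
    (Real.le_norm_self _).trans (h1.trans (mul_le_of_le_one_right hC0 h2))
  have h4 : h (point x) (proj s) - h (point x) (proj t) ≤ C := h3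
  linarith

/-- A function with vanishing mean for a positive weight cannot have a positive lower bound or a
negative upper bound, so the oscillation bound controls its size. -/
theorem exists_abs_le_of_centred {ρ h : Scales d m → Torus d → ℝ} (hρ : IsSmooth ρ)
    (hs : IsSmooth h) (hb : HasBoundedDerivatives h) (hpos : ∀ x y, 0 < ρ x y)
    (hcent : ∀ x, ∫ y, h x y * ρ x y = 0) : ∃ C : ℝ, ∀ x y, |h x y| ≤ C := by
  obtain ⟨C, hC⟩ := hb.exists_osc_le hs
  refine ⟨C, fun x y => ?_⟩
  have hρc : Continuous (ρ x) := (hρ.toC x).continuous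
  have hhc : Continuous (h x) := (hs.toC x).continuous
  have hpos' : 0 < ∫ z, ρ x z :=
    hρc.integral_pos_of_hasCompactSupport_nonneg_nonzero (HasCompactSupport.of_compactSpace _)
      (fun z => (hpos x z).le) (hpos x 0).ne'
  have key : ∀ s : ℝ, (∀ z, s ≤ h x z) → s ≤ 0 := fun s hsz => by
    have : s * ∫ z, ρ x z ≤ ∫ z, h x z * ρ x z := by
      rw [← integral_const_mul]
      refine integral_mono ((integrable_of_continuous hρc).const_mul _)
        (integrable_of_continuous (hhc.mul hρc)) fun z => ?_
      exact mul_le_mul_of_nonneg_right (hsz z) (hpos x z).le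
    rw [hcent] at this
    by_contra! hcon
    nlinarith [mul_pos hcon hpos']
  have key2 : ∀ s : ℝ, (∀ z, h x z ≤ s) → 0 ≤ s := fun s hsz => by
    have : ∫ z, h x z * ρ x z ≤ s * ∫ z, ρ x z := by
      rw [← integral_const_mul]
      refine integral_mono (integrable_of_continuous (hhc.mul hρc))
        ((integrable_of_continuous hρc).const_mul _) fun z => ?_
      exact mul_le_mul_of_nonneg_right (hsz z) (hpos x z).le
    rw [hcent] at this
    by_contra! hcon
    nlinarith [mul_pos (neg_pos.2 hcon) hpos']
  have h1 := key (h x y - C) fun z => by linarith [hC x y z]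
  have h2 := key2 (h x y + C) fun z => by linarith [hC x z y]
  exact abs_le.2 ⟨by linarith, by linarith⟩

theorem translate_zero (φ : C(Torus d, ℝ)) : translate 0 φ = φ := by
  ext y; simp [translate]

theorem translate_proj_zero (φ : C(Torus d, ℝ)) : translate (proj 0) φ = φ := by
  rw [proj_zero, translate_zero]

/-- Weak solutions of a smooth family of elliptic equations are given by a smooth function. -/
theorem exists_smooth_weakSol {a : Fin d → Fin d → Scales d m → Torus d → ℝ}
    {g : Scales d m → Torus d → ℝ} (ha : ∀ i j, IsSmooth (a i j)) (hg : IsSmooth g) {c : ℝ}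
    (hc : 0 < c) (hell : ∀ x, IsElliptic c fun i j => a i j x) :
    (ContDiff ℝ ∞ fun x : (Fin d → ℝ) × (Fin m → Fin d → ℝ) =>
      comp none (weakSol (fun i j => (ha i j).toC (point x)) (hg.toC (point x)))) ∧
    ∃ v : Scales d m → Torus d → ℝ, IsSmooth v ∧
      ∀ x, comp none (weakSol (fun i j => (ha i j).toC x) (hg.toC x)) =ᵐ[volume] v x := by
  -- The translation is treated as one more parameter of the coefficients, so smoothness of the
  -- orbit is smooth dependence on parameters.
  let F : ((Fin d → ℝ) × (Fin m → Fin d → ℝ)) × (Fin d → ℝ) → L2 d := fun p =>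
    comp none (weakSol (fun i j => translate (proj p.2) ((ha i j).toC (point p.1)))
      (translate (proj p.2) (hg.toC (point p.1))))
  have hF : ContDiff ℝ ∞ F := by
    refine (comp none).contDiff.comp (contDiff_weakSol (fun i j => ?_) ?_ fun p => ?_)
    · exact contDiff_translate (Φ := fun x => (ha i j).toC (point x)) (isSmooth_iff.1 (ha i j))
    · exact contDiff_translate (Φ := fun x => hg.toC (point x)) (isSmooth_iff.1 hg)
    · exact ⟨c, hc, fun y ξ => hell (point p.1) (y + proj p.2) ξ⟩
  have hF0 : ∀ x, F (x, 0) =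
      comp none (weakSol (fun i j => (ha i j).toC (point x)) (hg.toC (point x))) := fun x => by
    simp only [F, translate_proj_zero]
  obtain ⟨h1, h2⟩ := exists_smooth_of_orbit hF fun x t => by
    rw [hF0]
    exact weakSol_translate hc (hell (point x)) _ (proj t)
  simp_rw [hF0] at h1 h2
  constructor
  · have h0 : ContDiff ℝ ∞ fun x : (Fin d → ℝ) × (Fin m → Fin d → ℝ) => (x, (0 : Fin d → ℝ)) := by
      fun_prop
    have := hF.comp h0
    simp only [Function.comp_def, hF0] at this
    exact this
  · refine ⟨fun x y => (∑' n, fcoef n (comp none (weakSol (fun i j => (ha i j).toC x) (hg.toC x))) *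
      mFourier n y).re, isSmooth_iff.2 h1, fun x => ?_⟩
    obtain ⟨x, rfl⟩ := point_surjective x
    exact h2 x

theorem IsSmooth.contDiff_toC {f : Scales d m → Torus d → ℝ} (hf : IsSmooth f) :
    ContDiff ℝ ∞ fun x : (Fin d → ℝ) × (Fin m → Fin d → ℝ) => hf.toC (point x) :=
  contDiff_family (isSmooth_iff.1 hf)

end Multiscale

/-! ### Assembly: normalisation by the `ρ`-mean, and uniqueness -/

theorem mainTheorem8 (d m : ℕ)
    (ρ : Multiscale.Scales d m → Multiscale.Torus d → ℝ)
    (D : Multiscale.Scales d m → Multiscale.Torus d → Matrix (Fin d) (Fin d) ℝ)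
    (h : Multiscale.Scales d m → Multiscale.Torus d → ℝ)
    (hρ_smooth : Multiscale.IsSmooth ρ)
    (hρ_lower : ∃ c : ℝ, 0 < c ∧ ∀ x y, c ≤ ρ x y)
    (hρ_upper : ∃ C : ℝ, ∀ x y, ρ x y ≤ C)
    (hD_smooth : ∀ i j, Multiscale.IsSmooth (fun x y => D x y i j))
    (hD_pos : ∃ c : ℝ, 0 < c ∧ ∀ x y, ∀ ξ : Fin d → ℝ,
      c * ∑ i, ξ i ^ 2 ≤ ∑ i, ∑ j, ξ i * D x y i j * ξ j)
    (hh_smooth : Multiscale.IsSmooth h)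
    (hh_bdd : Multiscale.HasBoundedDerivatives h)
    (hh_centred : ∀ x, ∫ y, h x y * ρ x y = 0) :
    ∃ u : Multiscale.Scales d m → Multiscale.Torus d → ℝ,
      -- `u` is smooth and bounded jointly in all the variables
      Multiscale.IsSmooth u ∧
      (∃ C : ℝ, ∀ x y, |u x y| ≤ C) ∧
      ∀ x,
        -- it solves the equation, in the classical and in the weak sense, and has mean zero
        (∀ y, Multiscale.ellipticOp (ρ x) (D x) (u x) y = h x y) ∧
        Multiscale.IsWeakSolution (ρ x) (D x) (h x) (u x) ∧
        ∫ y, u x y * ρ x y = 0 ∧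
        -- it is the only mean-zero solution in `H^1`, as an element of `L^2`
        ∀ v : Multiscale.Torus d → ℝ,
          Multiscale.IsWeakSolution (ρ x) (D x) (h x) v → ∫ y, v y * ρ x y = 0 →
            v =ᵐ[volume] u x := by
  open Multiscale in
  obtain ⟨c₁, hc₁, hρ₁⟩ := hρ_lower
  obtain ⟨C, hC⟩ := hρ_upper
  obtain ⟨c₂, hc₂, hD₂⟩ := hD_pos
  have hpos : ∀ x y, 0 < ρ x y := fun x y => hc₁.trans_le (hρ₁ x y)
  obtain ⟨H, hH⟩ := exists_abs_le_of_centred hρ_smooth hh_smooth hh_bdd hpos hh_centred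
  have hC0 : 0 ≤ C := (hpos (0, 0) 0).le.trans (hC _ _)
  have ha : ∀ i j, IsSmooth fun x y => ρ x y * D x y i j := fun i j =>
    ContDiff.mul hρ_smooth (hD_smooth i j)
  have hg : IsSmooth fun x y => ρ x y * h x y := ContDiff.mul hρ_smooth hh_smooth
  set c := c₁ * c₂
  have hc : 0 < c := mul_pos hc₁ hc₂
  have hell : ∀ x, IsElliptic c fun i j y => ρ x y * D x y i j := fun x y ξ => by
    have h0 : 0 ≤ c₂ * ∑ i, ξ i ^ 2 := by positivity
    calc c * ∑ i, ξ i ^ 2 = c₁ * (c₂ * ∑ i, ξ i ^ 2) := by ring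
      _ ≤ ρ x y * ∑ i, ∑ j, ξ i * D x y i j * ξ j :=
        mul_le_mul (hρ₁ x y) (hD₂ x y ξ) h0 (hpos x y).le
      _ = _ := by
        simp_rw [Finset.mul_sum]
        refine Finset.sum_congr rfl fun i _ => Finset.sum_congr rfl fun j _ => ?_
        ring
  obtain ⟨hV, v, hv, hVv⟩ := exists_smooth_weakSol ha hg hc hell
  set A : Scales d m → Fin d → Fin d → C(Torus d, ℝ) := fun x i j => (ha i j).toC x
  set g : Scales d m → C(Torus d, ℝ) := fun x => hg.toC x
  set R : Scales d m → C(Torus d, ℝ) := fun x => hρ_smooth.toC x 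
  have hg0 : ∀ x, ∫ y, g x y = 0 := fun x => by
    rw [← hh_centred x]; congr 1; ext y; exact mul_comm _ _
  have hgH : ∀ x y, |g x y| ≤ C * H := fun x y => by
    change |ρ x y * h x y| ≤ _
    rw [abs_mul, abs_of_pos (hpos x y)]
    exact mul_le_mul (hC x y) (hH x y) (abs_nonneg _) hC0
  have hρi : ∀ x, Integrable (ρ x) volume := fun x => integrable_of_continuous (R x).continuous
  have hvi : ∀ x, Continuous (v x) := fun x => (hv.toC x).continuous
  have hρpos : ∀ x, 0 < ∫ y, ρ x y := fun x =>
    (R x).continuous.integral_pos_of_hasCompactSupport_nonneg_nonzero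
      (HasCompactSupport.of_compactSpace _) (fun z => (hpos x z).le) (hpos x 0).ne'
  have hvρ : ∀ x, Integrable (fun y => v x y * ρ x y) volume := fun x =>
    integrable_of_continuous ((hvi x).mul (R x).continuous)
  -- Independent of `x`: only `d`, the ellipticity constant `c` and the bound `C * H` for `|g|`
  -- enter.
  set M := deGiorgiBound d ((C * H + 1) / c) ((C * H / c) ^ 2)
  have hvG : ∀ x, MemH1 (v x) fun i => pderiv i (v x) := fun x =>
    memH1_of_contDiff (hv.isSmoothTorus x).contDiff_one
  -- Uniqueness of weak gradients replaces the Lax-Milgram gradient by the classical one of the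
  -- smooth representative.
  have hweak : ∀ x, WeakForm (A x) (g x) fun i => pderiv i (v x) := fun x =>
    (weakForm_weakSol hc (hell x) (g x)).congr
      (((memH1_comp _).congr_ae (hVv x) fun i => Filter.EventuallyEq.rfl).grad_unique (hvG x))
  have hv0 : ∀ x, ∫ y, v x y = 0 := fun x => by
    rw [← integral_congr_ae (hVv x), integral_comp_none]
  have hvM : ∀ x y, |v x y| ≤ M := fun x =>
    (hweak x).abs_le_bound hc (hell x) (hgH x) (hg0 x) (hv.isSmoothTorus x) (hv0 x)
  set μ : Scales d m → ℝ := fun x => (∫ y, v x y * ρ x y) / ∫ y, ρ x y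
  have hμM : ∀ x, |μ x| ≤ M := fun x => by
    rw [abs_div, abs_of_pos (hρpos x), div_le_iff₀ (hρpos x), ← integral_const_mul]
    refine (abs_integral_le_integral_abs).trans (integral_mono
      (hvρ x).abs ((hρi x).const_mul M)
      fun y => ?_)
    simp only [abs_mul, abs_of_pos (hpos x y)]
    exact mul_le_mul_of_nonneg_right (hvM x y) (hpos x y).le
  -- Numerator and denominator are `L^2` inner products of smooth `L^2`-valued maps, so no
  -- differentiation under the integral is needed.
  have hμs : ContDiff ℝ ∞ fun x : (Fin d → ℝ) × (Fin m → Fin d → ℝ) => μ (point x) := by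
    have hRs := (toL2 d).contDiff.comp hρ_smooth.contDiff_toC
    refine ContDiff.div ?_ ?_ fun x => (hρpos _).ne'
    · have h1 := hRs.inner ℝ hV
      refine (congrArg (ContDiff ℝ ∞) (funext fun x => ?_)).mp h1
      rw [Function.comp_apply, inner_toL2]
      refine integral_congr_ae ?_
      filter_upwards [hVv (point x)] with y hy
      rw [hy, mul_comm]; rfl
    · have h1 := hRs.inner ℝ (contDiff_const (c := toL2 d 1))
      refine (congrArg (ContDiff ℝ ∞) (funext fun x => ?_)).mp h1
      rw [Function.comp_apply, inner_toL2]
      refine integral_congr_ae ?_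
      filter_upwards [coeFn_toL2 (1 : C(Torus d, ℝ))] with y hy
      rw [hy]
      simp [IsSmooth.toC]
  set u : Scales d m → Torus d → ℝ := fun x y => v x y - μ x
  have hu : IsSmooth u := isSmooth_iff.2
    ((isSmooth_iff.1 hv).sub (hμs.comp contDiff_fst))
  have hpu : ∀ x i, pderiv i (u x) = pderiv i (v x) := fun x i => by
    ext y
    simp only [pderiv, u, deriv_sub_const]
  have huG : ∀ x, MemH1 (u x) fun i => pderiv i (v x) := fun x => by
    simpa using (hvG x).sub (memH1_const (μ x))
  have hdens : ∀ x (G W : Fin d → Torus d → ℝ), (∀ i, MemLp (G i) 2 volume) →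
      (∀ i, MemLp (W i) 2 volume) → ∫ y, ρ x y * ∑ i, (∑ j, D x y i j * G j y) * W i y =
        ∑ i, ∑ j, ∫ y, A x i j y * G j y * W i y := fun x G W hG hW =>
    integral_density_form (ρ := R x) (fun i j y => rfl) hG hW
  refine ⟨u, hu, ⟨M + M, fun x y => (abs_sub _ _).trans (add_le_add (hvM x y) (hμM x))⟩,
    fun x => ⟨fun y => ?_, ⟨_, huG x, fun w W hw => ?_⟩, ?_, ?_⟩⟩
  · have h1 := (hweak x).classical (fun i j => (ha i j).isSmoothTorus x) (hv.isSmoothTorus x)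
      (hg0 x) y
    have h2 : ∀ i, (fun z => ρ x z * ∑ j, D x z i j * pderiv j (u x) z) =
        fun z => ∑ j, A x i j z * pderiv j (v x) z := fun i => by
      ext z
      rw [Finset.mul_sum]
      refine Finset.sum_congr rfl fun j _ => ?_
      rw [hpu, ← mul_assoc]; rfl
    simp only [ellipticOp, h2]
    rw [h1]
    change 1 / ρ x y * (ρ x y * h x y) = h x y
    have := (hpos x y).ne'
    field_simp
  · rw [hdens x _ _ (huG x).memLp_grad hw.memLp_grad, (hweak x).apply (hg0 x) hw]
    rfl
  · simp only [u, sub_mul]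
    rw [integral_sub (hvρ x) ((hρi x).const_mul _), integral_const_mul, div_mul_cancel₀ _ (hρpos x).ne', sub_self]
  · rintro w ⟨G, hwG, hw⟩ hw0
    have hGw : WeakForm (A x) (g x) G := fun φ Φ hφ _ => by
      rw [← hdens x _ _ hwG.memLp_grad hφ.memLp_grad, hw φ Φ hφ]
      rfl
    obtain ⟨s, hs⟩ := WeakForm.unique (a := A x) hc (hell x) hwG (hvG x) hGw (hweak x)
    have h1 : ∫ y, w y * ρ x y = (∫ y, v x y * ρ x y) + s * ∫ y, ρ x y := by
      rw [← integral_const_mul, ← integral_add (hvρ x) ((hρi x).const_mul _)]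
      refine integral_congr_ae ?_
      filter_upwards [hs] with y hy
      rw [hy]; ring
    -- The vanishing `ρ`-mean of `w` fixes the free constant.
    have h2 : s = - μ x := by
      rw [hw0] at h1
      simp only [μ]
      have := (hρpos x).ne'
      field_simp
      linarith
    filter_upwards [hs] with y hy
    rw [hy, h2]; simp only [u]; ring
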